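/- Notation. For complex $b$ with $\mathrm{Re}(b)>0$ and $\mathrm{Re}(b^2)>0$, Faddeev's quantum dilogarithm is $$\Phi_b(w)=\exp\left(\int_{\mathbb R+i\epsilon}\frac{e^{-2ixw}}{4\sinh(xb)\sinh(x/b)}\,\frac{dx}{x}\right),\qquad |\mathrm{Im}(w)|<\tfrac12\mathrm{Re}(b+b^{-1}),$$ with $\epsilon>0$ small ($\epsilon<\pi\min\{\mathrm{Re}(b),\mathrm{Re}(b^{-1})\}$), continued analytically in $w$. On the strip $|\mathrm{Im}(z)|<\pi$ the function $z\mapsto\log\Phi_b\left(\frac{z}{2\pi b}\right)$ denotes the holomorphic function that equals the above integral (at $w=\frac{z}{2\pi b}$) for all $z$ of the strip with $|\mathrm{Im}\frac{z}{2\pi b}|<\frac12\mathrm{Re}(b+b^{-1})$; for $b>0$ these are all $z$ of the strip. $\mathrm{Li}_2(w)=-\int_0^1\log(1-wt)\frac{dt}{t}$ is Euler's dilogarithm on $\mathbb C\setminus[1,\infty)$ (equal to $\sum_{k\ge1}w^k/k^2$ for $|w|<1$), $B_{m}(x)$ is the $m$-th Bernoulli polynomial, and $\partial_z$ is the derivative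 with respect to $z$. Corollary 1.4. Let $\tau\in\mathbb C$ with $\mathrm{Re}(\tau)>0$ and let $b$ be its square root with $\mathrm{Re}(b)>0$, so that $b^2=\tau$. Then the function $z\mapsto\log\Phi_b\left(\frac{z}{2\pi b}\right)$ on the strip $|\mathrm{Im}(z)|<\pi$ exists, the integrals above being absolutely convergent, and for every $\delta$ with $0<\delta<\pi$, all $z\in\mathbb C$ with $|\mathrm{Im}(z)|<\pi-\delta$ and all integers $N\ge0$, $$\left|\log\Phi_b\left(\frac{z}{2\pi b}\right)-\sum_{n=0}^N(2\pi i)^{2n-1}\frac{B_{2n}(1/2)}{(2n)!}\,\partial_z^{2n}\mathrm{Li}_2(-e^z)\,\tau^{2n-1}\right|\le L\,M^{2N}\,(2N)!\,\frac{|\tau|^2}{\mathrm{Re}(\tau)}\,|\tau|^{2N},$$ where $$M=\frac2\delta,\qquad L=\max\left\{2,\frac{\pi^2}{3\sin(|\mathrm{Im}(z)|+\delta)}\right\}.$$ For $\tau>0$ the factor $\frac{|\tau|^2}{\mathrm{Re}(\tau)}=\frac{1}{\mathrm{Re}(1/\tau)}$ is $\mathrm{Re}(\tau)=\tau$. -/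

import Mathlib

noncomputable section

/-- Euler's dilogarithm on `ℂ ∖ [1, ∞)`, with the principal logarithm:
`Li₂(w) = -∫₀¹ log(1 - w t) / t dt`. It is the analytic continuation of `∑ wᵏ / k²`,
see `dilog_hasSum`. -/
def dilog (w : ℂ) : ℂ :=
  -∫ t in (0 : ℝ)..1, Complex.log (1 - w * (t : ℂ)) / (t : ℂ)

/-- On the open unit disc, `dilog` is the sum of Euler's series. -/
theorem dilog_hasSum {w : ℂ} (hw : ‖w‖ < 1) :
    HasSum (fun k : ℕ => w ^ (k + 1) / ((k : ℂ) + 1) ^ 2) (dilog w) := by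
  have key : HasSum (fun k : ℕ => ∫ t in (0 : ℝ)..1, w ^ (k + 1) * (t : ℂ) ^ k / ((k : ℂ) + 1))
      (∫ t in (0 : ℝ)..1, -(Complex.log (1 - w * (t : ℂ)) / (t : ℂ))) := by
    refine intervalIntegral.hasSum_integral_of_dominated_convergence
      (fun k _ => ‖w‖ ^ (k + 1)) ?_ ?_ ?_ ?_ ?_
    · intro k
      exact (by fun_prop : Continuous fun t : ℝ =>
        w ^ (k + 1) * (t : ℂ) ^ k / ((k : ℂ) + 1)).aestronglyMeasurable
    · intro k
      refine Filter.Eventually.of_forall fun t ht => ?_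
      rw [Set.uIoc_of_le zero_le_one] at ht
      have h1 : ‖(t : ℂ)‖ ^ k ≤ 1 := by
        rw [Complex.norm_real, Real.norm_of_nonneg ht.1.le]
        exact pow_le_one₀ ht.1.le ht.2
      have h2 : (1 : ℝ) ≤ ‖((k : ℂ) + 1)‖ := by
        have : ((k : ℂ) + 1) = ((k + 1 : ℕ) : ℂ) := by push_cast; ring
        rw [this, Complex.norm_natCast]
        exact_mod_cast Nat.succ_le_succ (Nat.zero_le k)
      rw [norm_div, norm_mul, norm_pow, norm_pow]
      calc _ ≤ ‖w‖ ^ (k + 1) * ‖(t : ℂ)‖ ^ k := div_le_self (by positivity) h2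
        _ ≤ _ := mul_le_of_le_one_right (by positivity) h1
    · refine Filter.Eventually.of_forall fun t _ => ?_
      exact (summable_nat_add_iff 1).2 (summable_geometric_of_lt_one (norm_nonneg _) hw)
    · exact intervalIntegrable_const
    · refine Filter.Eventually.of_forall fun t ht => ?_
      rw [Set.uIoc_of_le zero_le_one] at ht
      have ht0 : (t : ℂ) ≠ 0 := by exact_mod_cast ht.1.ne'
      have hlt : ‖w * (t : ℂ)‖ < 1 := by
        rw [norm_mul, Complex.norm_real, Real.norm_of_nonneg ht.1.le]
        nlinarith [norm_nonneg w, ht.1, ht.2]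
      have h := (Complex.hasSum_taylorSeries_neg_log' hlt).div_const (t : ℂ)
      rw [← neg_div]
      have hf : (fun k : ℕ => w ^ (k + 1) * (t : ℂ) ^ k / ((k : ℂ) + 1)) =
          fun k : ℕ => (w * (t : ℂ)) ^ (k + 1) / ((k : ℂ) + 1) / (t : ℂ) := by
        funext k
        rw [mul_pow, pow_succ (t : ℂ) k]
        field_simp
      rw [hf]
      exact h
  rw [intervalIntegral.integral_neg] at key
  unfold dilog
  convert key using 1
  funext k
  have hk : ((k : ℂ) + 1) ≠ 0 := by exact_mod_cast Nat.succ_ne_zero k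
  have hfun : (fun t : ℝ => w ^ (k + 1) * (t : ℂ) ^ k / ((k : ℂ) + 1)) =
      fun t : ℝ => (w ^ (k + 1) / ((k : ℂ) + 1)) * (t : ℂ) ^ k := by
    funext t
    ring
  have hint : ∫ t in (0 : ℝ)..1, (t : ℂ) ^ k = 1 / ((k : ℂ) + 1) := by
    have h : ∫ t in (0 : ℝ)..1, ((t ^ k : ℝ) : ℂ) = ((∫ t in (0 : ℝ)..1, t ^ k : ℝ) : ℂ) :=
      intervalIntegral.integral_ofReal
    simp only [Complex.ofReal_pow] at h
    rw [h, integral_pow]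
    simp
  rw [hfun, intervalIntegral.integral_const_mul, hint]
  field_simp

/-- The integrand `exp(-2 i x w) / (4 sinh(x b) sinh(x / b) x)` of Faddeev's quantum
dilogarithm `Φ_b(w)`. -/
def faddeevIntegrand (b w x : ℂ) : ℂ :=
  Complex.exp (-2 * Complex.I * x * w) /
    (4 * Complex.sinh (x * b) * Complex.sinh (x / b) * x)

/-- `ℓ` is the function `z ↦ log Φ_b(z / (2 π b))` on the strip `|Im z| < π` (for `Re b > 0`,
`Re b² > 0`).

Faddeev's quantum dilogarithm is `Φ_b(w) = exp (∫_{ℝ + iε} faddeevIntegrand b w x dx)` where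
the integral converges, that is for `|Im w| < Re (b + 1/b) / 2`, and it is extended
analytically in `w` from there. Its logarithm is the exponent, continued in the same way.
So `ℓ` is required to be holomorphic on the strip and to be equal to the (absolutely
convergent) integral at each `z` of the strip such that `w = z / (2 π b)` satisfies the
inequality; these `z` form a convex neighbourhood of `0` in the strip, so that `ℓ` is unique
on the strip. If `b` is real, every `z` of the strip satisfies it.

The line `ℝ + iε` may be any one that runs between the pole `0` of the integrand and its
poles in the upper half-plane, which are `π i n b` and `π i n / b`, `n ≥ 1`. -/
structure IsLogQuantumDilog (b : ℂ) (ℓ : ℂ → ℂ) : Prop where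
  holomorphic : DifferentiableOn ℂ ℓ {z : ℂ | |z.im| < Real.pi}
  integrable : ∀ z : ℂ, |z.im| < Real.pi →
    |(z / (2 * Real.pi * b)).im| < (b + b⁻¹).re / 2 →
    ∀ ε : ℝ, 0 < ε → ε < Real.pi * min b.re (b⁻¹).re →
      MeasureTheory.Integrable fun t : ℝ =>
        faddeevIntegrand b (z / (2 * Real.pi * b)) ((t : ℂ) + ε * Complex.I)
  eq_integral : ∀ z : ℂ, |z.im| < Real.pi →
    |(z / (2 * Real.pi * b)).im| < (b + b⁻¹).re / 2 →
    ∀ ε : ℝ, 0 < ε → ε < Real.pi * min b.re (b⁻¹).re →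
      ℓ z = ∫ t : ℝ,
        faddeevIntegrand b (z / (2 * Real.pi * b)) ((t : ℂ) + ε * Complex.I)

/-- The `n`-th term `(2πi)^(2n-1) B_{2n}(1/2) / (2n)! · ∂_z^{2n} Li₂(-e^z) · τ^(2n-1)`, with
an integer exponent `2n - 1`, which is `-1` for `n = 0`. -/
def asympTerm (τ z : ℂ) (n : ℕ) : ℂ :=
  (2 * Real.pi * Complex.I) ^ (2 * (n : ℤ) - 1) *
    ((((Polynomial.bernoulli (2 * n)).eval (1 / 2 : ℚ) : ℚ) : ℂ) / (Nat.factorial (2 * n) : ℂ)) *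
    iteratedDeriv (2 * n) (fun u : ℂ => dilog (-Complex.exp u)) z *
    τ ^ (2 * (n : ℤ) - 1)

end

/-!
# The asymptotic expansion of Faddeev's quantum dilogarithm, with an explicit remainder

Let `σ(s) = 1 / (1 + exp (-s))` be the logistic function and `κ = 1 / τ = 1 / b²`. On the strip
`|Im z| < π` the logarithm of the quantum dilogarithm has the closed form (`laplaceLogDilog`)

`log Φ_b(z / (2πb)) = κ Li₂(-e^z) / (2πi)
  + i / (2π) ∑_{k ≥ 1} (-1)^(k-1) / k² ∫₀^∞ e^{-κv} (σ(z + v/k) + σ(z - v/k)) dv`.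

The expansion is read off from it. Two integrations by parts turn the Laplace integral of an even
function into its value at `0` plus `τ²` times the Laplace integral of its second derivative
(`logisticLaplace_eq_add`). The boundary terms are the even derivatives of `σ`, which are those of
`-Li₂(-e^z)` shifted by two, and the sums over `k` are the values `η(2n)` of the alternating zeta
function, which give the Bernoulli factors (`hasSum_alternating_zeta_even`). The remainder is the
Laplace integral of the `2N`-th derivative (`laplaceLogDilog_sub_sum`); it is bounded by Cauchy's
estimate on a disc of radius `δ`, together with `∫₀^∞ |e^{-κv}| dv = 1 / Re κ = |τ|² / Re τ`.

For the closed form, let first `b > 0`. Then `1 / (x sinh (x b))` is the Fourier integral of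
`log (1 + e^v)` (a Beta integral), and the Fourier transform of `1 / sinh` is a multiple of `σ`.
Fubini's theorem makes Faddeev's integral a multiple of the convolution
`∫ log (1 + e^v) σ(z - τv) dv` (`integral_faddeevIntegrand_ofReal`). For `v > 0` split
`log (1 + e^v) = v + log (1 + e^{-v})`: the first summand yields the dilogarithm, and the logarithmic
series yields the sum over `k` (`integral_log_one_add_exp_mul_logistic`).

Both sides are holomorphic in `b` and in `z`. For fixed `ε` and `|z| < 1` the admissible `b` form
a convex open set that contains `1`, so that the identity theorem carries the closed form from real
to complex `b` (`integral_faddeevIntegrand_of_norm_lt_one`); no contour has to be rotated. A second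
application, now in `z`, reaches all `z` at which the integral is considered.
-/

open MeasureTheory Filter Topology Set

/-! ### Holomorphic parameter integrals -/

/-- A parameter integral is holomorphic as soon as the integrand is holomorphic in the parameter
and locally uniformly dominated: Cauchy's estimate supplies the bound on the derivative. -/
theorem differentiableAt_integral_of_dominated {α : Type*} [MeasurableSpace α] {μ : Measure α}
    {f : ℂ → α → ℂ} {V : Set ℂ} {p₀ : ℂ} {bound : α → ℝ} (hV : V ∈ 𝓝 p₀)
    (hmeas : ∀ p ∈ V, AEStronglyMeasurable (f p) μ)
    (hdiff : ∀ᵐ a ∂μ, DifferentiableOn ℂ (fun p => f p a) V)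
    (hbound : ∀ᵐ a ∂μ, ∀ p ∈ V, ‖f p a‖ ≤ bound a) (hint : Integrable bound μ) :
    DifferentiableAt ℂ (fun p => ∫ a, f p a ∂μ) p₀ := by
  obtain ⟨r, hr, hrV⟩ := Metric.mem_nhds_iff.1 hV
  have hp₀ : p₀ ∈ V := mem_of_mem_nhds hV
  have hmeas' : AEStronglyMeasurable (fun a => deriv (fun p => f p a) p₀) μ := by
    -- the derivative is a limit of difference quotients along `p₀ + r / (n + 2)`
    set h : ℕ → ℂ := fun n => (r : ℂ) / ((n : ℂ) + 2) with hh
    have hn2 : ∀ n : ℕ, ((n : ℂ) + 2) ≠ 0 := fun n => by exact_mod_cast (by omega : n + 2 ≠ 0)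
    have h0 : ∀ n, h n ≠ 0 := fun n => div_ne_zero (by exact_mod_cast hr.ne') (hn2 n)
    have hlim : Tendsto h atTop (𝓝 0) := by
      have := (tendsto_const_div_atTop_nhds_zero_nat (𝕜 := ℂ) (r : ℂ)).comp (tendsto_add_atTop_nat 2)
      refine this.congr fun n => ?_
      simp [hh]
    have hmem : ∀ n, p₀ + h n ∈ V := fun n => hrV <| by
      have : ‖((n : ℂ) + 2)‖ = (n : ℝ) + 2 := by
        rw [show ((n : ℂ) + 2) = ((n + 2 : ℕ) : ℂ) by push_cast; ring, Complex.norm_natCast]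
        push_cast; ring
      simp only [hh, Metric.mem_ball, dist_self_add_left, norm_div, this, Complex.norm_real,
        Real.norm_of_nonneg hr.le]
      exact div_lt_self hr (by have := n.cast_nonneg (α := ℝ); linarith)
    refine aestronglyMeasurable_of_tendsto_ae (u := atTop)
      (f := fun n a => (h n)⁻¹ • (f (p₀ + h n) a - f p₀ a)) (fun n =>
        ((hmeas _ (hmem n)).sub (hmeas _ hp₀)).const_smul (h n)⁻¹) ?_
    filter_upwards [hdiff] with a ha
    have := (ha.differentiableAt hV).hasDerivAt.tendsto_slope_zero
    exact this.comp (tendsto_nhdsWithin_iff.2 ⟨hlim, Eventually.of_forall h0⟩)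
  have key := hasDerivAt_integral_of_dominated_loc_of_deriv_le (𝕜 := ℂ) (μ := μ) (F := f)
    (F' := fun p a => deriv (fun p => f p a) p) (x₀ := p₀) (s := Metric.ball p₀ (r / 2))
    (bound := fun a => bound a / (r / 2)) (Metric.ball_mem_nhds _ (half_pos hr))
    (by filter_upwards [hV] with p hp using hmeas p hp)
    (hint.mono' (hmeas _ hp₀) (by filter_upwards [hbound] with a ha using ha _ hp₀)) hmeas'
    ?_ (hint.div_const _) ?_
  · exact key.2.differentiableAt
  · filter_upwards [hdiff, hbound] with a ha hb p hp
    have hsub : Metric.closedBall p (r / 2) ⊆ V := fun q hq => hrV <| by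
      rw [Metric.mem_closedBall] at hq
      rw [Metric.mem_ball] at hp ⊢
      linarith [dist_triangle q p p₀]
    refine Complex.norm_deriv_le_of_forall_mem_sphere_norm_le (half_pos hr) ?_ fun q hq =>
      hb q (hsub (Metric.sphere_subset_closedBall hq))
    refine DifferentiableOn.diffContOnCl ?_
    rw [closure_ball _ (half_pos hr).ne']
    exact ha.mono hsub
  · filter_upwards [hdiff] with a ha p hp
    refine (ha.differentiableAt ?_).hasDerivAt
    exact mem_of_superset (Metric.ball_mem_nhds _ (by
      rw [Metric.mem_ball] at hp
      linarith : (0 : ℝ) < r - dist p p₀)) fun q hq => hrV <| by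
        rw [Metric.mem_ball] at hq ⊢
        linarith [dist_triangle q p p₀]

theorem integrable_exp_neg_mul_abs {k : ℝ} (hk : 0 < k) :
    Integrable fun t : ℝ => Real.exp (-(k * |t|)) := by
  rw [← integrableOn_univ, ← Iic_union_Ioi (a := (0 : ℝ)), integrableOn_union]
  constructor
  · refine (integrableOn_exp_mul_Iic hk 0).congr_fun (fun t ht => ?_) measurableSet_Iic
    simp only [abs_of_nonpos (mem_Iic.1 ht)]
    ring_nf
  · refine (integrableOn_exp_mul_Ioi (neg_neg_of_pos hk) 0).congr_fun (fun t ht => ?_)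
      measurableSet_Ioi
    simp only [abs_of_pos (mem_Ioi.1 ht)]
    ring_nf

/-- On lines `ω t + d` that avoid the zeros of `sinh`, the function `|sinh (ω t + d)|` grows like
`exp (k |t|)` for each `k < Re ω`, locally uniformly in the line. -/
theorem eventually_exp_le_norm_sinh {ω₀ d₀ : ℂ} {k : ℝ} (hω : 0 < ω₀.re) (hk : k < ω₀.re)
    (h0 : ∀ t : ℝ, Complex.sinh (ω₀ * t + d₀) ≠ 0) :
    ∃ m > 0, ∀ᶠ q : ℂ × ℂ in 𝓝 (ω₀, d₀), ∀ t : ℝ,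
      m * Real.exp (k * |t|) ≤ ‖Complex.sinh (q.1 * t + q.2)‖ := by
  obtain ⟨k', hk1, hk2⟩ : ∃ k', max k 0 < k' ∧ k' < ω₀.re := exists_between (max_lt hk hω)
  have hk' : k < k' := (le_max_left _ _).trans_lt hk1
  have hk'0 : 0 < k' := (le_max_right _ _).trans_lt hk1
  set D : ℝ := |d₀.re| + 1
  obtain ⟨T, hT⟩ : ∃ T : ℝ, T * k' = D + 1 := ⟨(D + 1) / k', by field_simp⟩
  have hD : 0 < D := by positivity
  have hT0 : 0 < T := by
    by_contra! h
    nlinarith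
  -- for `|t| ≥ T` the larger of the two exponentials in `sinh` dominates
  have hlarge : ∀ᶠ q : ℂ × ℂ in 𝓝 (ω₀, d₀), ∀ t : ℝ, T ≤ |t| →
      Real.exp (-D) / 4 * Real.exp (k * |t|) ≤ ‖Complex.sinh (q.1 * t + q.2)‖ := by
    have e1 : ∀ᶠ q : ℂ × ℂ in 𝓝 (ω₀, d₀), k' < q.1.re :=
      (Complex.continuous_re.comp continuous_fst).continuousAt.eventually (lt_mem_nhds hk2)
    have e2 : ∀ᶠ q : ℂ × ℂ in 𝓝 (ω₀, d₀), |q.2.re| < D :=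
      ((Complex.continuous_re.comp continuous_snd).abs).continuousAt.eventually
        (gt_mem_nhds (by simp [D]))
    filter_upwards [e1, e2] with q hq1 hq2 t ht
    set X := q.1 * t + q.2
    have hX : X.re = q.1.re * t + q.2.re := by simp [X]
    have hXabs : k' * |t| - D ≤ |X.re| := by
      have h1 : |q.1.re * t| - |q.2.re| ≤ |X.re| := by
        rw [hX]; simpa using abs_sub_abs_le_abs_sub (q.1.re * t) (-q.2.re)
      rw [abs_mul, abs_of_pos (hk'0.trans hq1)] at h1
      nlinarith [abs_nonneg t]
    have hX1 : 1 ≤ |X.re| := by nlinarith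
    have hs : Real.exp |X.re| / 4 ≤ ‖Complex.sinh X‖ := by
      have h1 : Real.exp |X.re| - Real.exp (-|X.re|) ≤ ‖Complex.exp X - Complex.exp (-X)‖ := by
        rcases le_total 0 X.re with h | h
        · have := norm_sub_norm_le (Complex.exp X) (Complex.exp (-X))
          simpa [Complex.norm_exp, abs_of_nonneg h] using this
        · have := norm_sub_norm_le (Complex.exp (-X)) (Complex.exp X)
          rw [norm_sub_rev]
          simpa [Complex.norm_exp, abs_of_nonpos h] using this
      have h2 : Real.exp (-|X.re|) ≤ 1 / 2 := by
        have := Real.add_one_le_exp |X.re|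
        rw [Real.exp_neg, inv_le_comm₀ (Real.exp_pos _) (by norm_num)]
        linarith
      have h3 := Real.add_one_le_exp |X.re|
      rw [Complex.sinh, norm_div]
      norm_num
      linarith
    refine le_trans ?_ hs
    rw [div_mul_eq_mul_div, ← Real.exp_add]
    gcongr
    nlinarith [abs_nonneg t]
  -- for `|t| ≤ T` compactness applies
  obtain ⟨t₁, -, ht₁⟩ := (isCompact_Icc (a := -T) (b := T)).exists_isMinOn
    (nonempty_Icc.2 (by linarith))
    (f := fun t : ℝ => ‖Complex.sinh (ω₀ * t + d₀)‖ * Real.exp (-(k * |t|)))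
    (by fun_prop)
  set m := ‖Complex.sinh (ω₀ * t₁ + d₀)‖ * Real.exp (-(k * |t₁|))
  have hm : 0 < m := mul_pos (norm_pos_iff.2 (h0 t₁)) (Real.exp_pos _)
  have hsmall : ∀ᶠ q : ℂ × ℂ in 𝓝 (ω₀, d₀), ∀ t ∈ Icc (-T) T,
      m / 2 < ‖Complex.sinh (q.1 * t + q.2)‖ * Real.exp (-(k * |t|)) := by
    refine isCompact_Icc.eventually_forall_of_forall_eventually fun t ht => ?_
    have hc : Continuous fun x : (ℂ × ℂ) × ℝ =>
        ‖Complex.sinh (x.1.1 * x.2 + x.1.2)‖ * Real.exp (-(k * |x.2|)) := by fun_prop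
    exact hc.continuousAt.eventually (lt_mem_nhds ((half_lt_self hm).trans_le (ht₁ ht)))
  refine ⟨min (Real.exp (-D) / 4) (m / 2), by positivity, ?_⟩
  filter_upwards [hlarge, hsmall] with q h1 h2 t
  rcases le_total T |t| with h | h
  · refine le_trans ?_ (h1 t h)
    gcongr
    exact min_le_left _ _
  · have := (h2 t (abs_le.1 h)).le
    rw [Real.exp_neg, ← div_eq_mul_inv, le_div_iff₀ (Real.exp_pos _)] at this
    refine le_trans ?_ this
    gcongr
    exact min_le_right _ _

/-! ### The logistic function -/

/-- The logistic function `σ(s) = 1 / (1 + exp (-s))`. -/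
noncomputable def logistic (s : ℂ) : ℂ := 1 / (1 + Complex.exp (-s))

/-- In a sector of half-opening `Y < π`, the distance to `-1` is bounded below. -/
theorem min_one_sin_le_norm_one_add {z : ℂ} {c Y : ℝ} (hc : 0 ≤ c) (hz : |z.im| ≤ Y)
    (hY : Y < Real.pi) : min 1 (Real.sin Y) ≤ ‖1 + c * Complex.exp z‖ := by
  set r := c * Real.exp z.re
  have hr : 0 ≤ r := by positivity
  have hn : ‖1 + c * Complex.exp z‖ ^ 2 = (1 + r * Real.cos z.im) ^ 2 + (r * Real.sin z.im) ^ 2 := by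
    rw [Complex.sq_norm, Complex.normSq_apply]
    simp [Complex.exp_re, Complex.exp_im, r]
    ring
  have hsq := Real.sin_sq_add_cos_sq z.im
  have hY0 : 0 ≤ Y := (abs_nonneg _).trans hz
  rcases le_or_gt 0 (Real.cos z.im) with h | h
  · refine (min_le_left _ _).trans ?_
    refine abs_le_of_sq_le_sq' ?_ (norm_nonneg _) |>.2
    rw [hn]
    nlinarith [mul_nonneg hr h, sq_nonneg (r * Real.sin z.im)]
  · refine (min_le_right _ _).trans ?_
    have h1 : Real.pi / 2 < |z.im| := by
      by_contra! h'
      rw [← Real.cos_abs] at h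
      exact absurd (Real.cos_nonneg_of_neg_pi_div_two_le_of_le (by linarith [abs_nonneg z.im,
        Real.pi_pos]) h') (not_le.2 h)
    have h2 : Real.sin Y ≤ Real.sin |z.im| := by
      rw [← Real.sin_pi_sub Y, ← Real.sin_pi_sub |z.im|]
      exact Real.sin_le_sin_of_le_of_le_pi_div_two (by linarith) (by linarith) (by linarith)
    have h3 : 0 ≤ Real.sin |z.im| := Real.sin_nonneg_of_nonneg_of_le_pi (abs_nonneg _) (by linarith)
    refine h2.trans (abs_le_of_sq_le_sq' ?_ (norm_nonneg _) |>.2)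
    have h4 : Real.sin |z.im| ^ 2 = Real.sin z.im ^ 2 := by
      rcases abs_choice z.im with h | h <;> simp [h]
    rw [hn, h4]
    nlinarith [sq_nonneg (r + Real.cos z.im)]

theorem min_one_sin_pos {Y : ℝ} (h0 : 0 < Y) (hY : Y < Real.pi) : 0 < min 1 (Real.sin Y) :=
  lt_min one_pos (Real.sin_pos_of_pos_of_lt_pi h0 hY)

theorem one_add_mul_exp_ne_zero {z : ℂ} {c : ℝ} (hc : 0 ≤ c) (hz : |z.im| < Real.pi) :
    1 + c * Complex.exp z ≠ 0 := by
  obtain ⟨Y, h1, h2⟩ := exists_between hz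
  exact norm_pos_iff.1 ((min_one_sin_pos ((abs_nonneg _).trans_lt h1) h2).trans_le
    (min_one_sin_le_norm_one_add hc h1.le h2))

theorem one_add_exp_ne_zero {z : ℂ} (hz : |z.im| < Real.pi) : 1 + Complex.exp z ≠ 0 := by
  simpa using one_add_mul_exp_ne_zero zero_le_one hz

theorem norm_logistic_le {z : ℂ} {Y : ℝ} (hY0 : 0 < Y) (hz : |z.im| ≤ Y) (hY : Y < Real.pi) :
    ‖logistic z‖ ≤ max 1 (1 / Real.sin Y) := by
  have h := min_one_sin_le_norm_one_add (z := -z) zero_le_one (by simpa using hz) hY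
  have hs := Real.sin_pos_of_pos_of_lt_pi hY0 hY
  rw [logistic, norm_div, norm_one]
  push_cast at h
  rw [one_mul] at h
  rcases min_le_iff.1 h with h' | h'
  · exact le_max_of_le_left ((div_le_one (by linarith)).2 h')
  · exact le_max_of_le_right (by gcongr)

theorem differentiableAt_logistic {z : ℂ} (hz : |z.im| < Real.pi) :
    DifferentiableAt ℂ logistic z := by
  have : 1 + Complex.exp (-z) ≠ 0 := one_add_exp_ne_zero (by simpa using hz)
  unfold logistic
  fun_prop (disch := assumption)

theorem isOpen_strip (c : ℝ) : IsOpen {z : ℂ | |z.im| < c} :=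
  isOpen_lt (Complex.continuous_im.abs) continuous_const

theorem convex_strip (c : ℝ) : Convex ℝ {z : ℂ | |z.im| < c} := by
  have : {z : ℂ | |z.im| < c} = Complex.imLm ⁻¹' (Ioo (-c) c) := by
    ext z; simp [abs_lt]
  rw [this]
  exact (convex_Ioo _ _).linear_preimage _

theorem logistic_eq {z : ℂ} : logistic z = Complex.exp z / (1 + Complex.exp z) := by
  have := Complex.exp_ne_zero z
  rw [logistic, Complex.exp_neg, ← mul_div_mul_left _ _ this]
  congr 1
  · ring
  · field_simp
    ring

theorem one_add_mul_exp_mem_slitPlane {z : ℂ} {c : ℝ} (hc : 0 ≤ c) (hz : |z.im| < Real.pi) :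
    1 + c * Complex.exp z ∈ Complex.slitPlane := by
  rw [Complex.mem_slitPlane_iff]
  by_contra! h
  have him : c * (Real.exp z.re * Real.sin z.im) = 0 := by
    simpa [Complex.exp_im, Complex.exp_re] using h.2
  have hre : 1 + c * (Real.exp z.re * Real.cos z.im) ≤ 0 := by
    simpa [Complex.exp_im, Complex.exp_re] using h.1
  rcases mul_eq_zero.1 him with h0 | h0
  · rw [h0] at hre
    norm_num at hre
  · have hs : Real.sin z.im = 0 := (mul_eq_zero.1 h0).resolve_left (Real.exp_ne_zero _)
    rw [Real.sin_eq_zero_iff_of_lt_of_lt (abs_lt.1 hz).1 (abs_lt.1 hz).2] at hs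
    rw [hs, Real.cos_zero] at hre
    have := mul_nonneg hc (Real.exp_pos z.re).le
    linarith

/-- `log (1 + exp z)` is an antiderivative of the logistic function on the strip. -/
theorem hasDerivAt_log_one_add_exp {z : ℂ} (hz : |z.im| < Real.pi) :
    HasDerivAt (fun z => Complex.log (1 + Complex.exp z)) (logistic z) z := by
  rw [logistic_eq]
  refine ((Complex.hasDerivAt_exp z).const_add 1).clog ?_
  simpa using one_add_mul_exp_mem_slitPlane zero_le_one hz

/-! ### The dilogarithm on the strip -/

/-- The integrand of the dilogarithm extends continuously to `t = 0`, as a difference quotient. -/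
theorem intervalIntegrable_dilog {z : ℂ} (hz : |z.im| < Real.pi) :
    IntervalIntegrable (fun t : ℝ => Complex.log (1 - -Complex.exp z * (t : ℂ)) / (t : ℂ))
      volume 0 1 := by
  set f : ℝ → ℂ := fun t => Complex.log (1 + t * Complex.exp z)
  have hd : ∀ t : ℝ, 0 ≤ t → DifferentiableAt ℝ f t := fun t ht =>
    (((Complex.ofRealCLM.hasDerivAt (x := t)).mul_const (Complex.exp z)).const_add
      1 |>.clog_real (one_add_mul_exp_mem_slitPlane ht hz)).differentiableAt
  have hc : ContinuousOn (dslope f 0) (uIcc 0 1) := by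
    rw [uIcc_of_le zero_le_one]
    intro t ht
    rcases eq_or_ne t 0 with rfl | h0
    · exact (continuousAt_dslope_same.2 (hd 0 le_rfl)).continuousWithinAt
    · exact ((continuousAt_dslope_of_ne h0).2 (hd t ht.1).continuousAt).continuousWithinAt
  refine hc.intervalIntegrable.congr fun t ht => ?_
  rw [uIoc_of_le zero_le_one] at ht
  simp only [dslope_of_ne _ ht.1.ne', slope, f, vsub_eq_sub, sub_zero]
  simp [div_eq_inv_mul, mul_comm]

theorem hasDerivAt_dilog_neg_exp {z : ℂ} (hz : |z.im| < Real.pi) :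
    HasDerivAt (fun z => dilog (-Complex.exp z)) (-Complex.log (1 + Complex.exp z)) z := by
  obtain ⟨Y, hY1, hY2⟩ := exists_between hz
  have hY0 : 0 < Y := (abs_nonneg _).trans_lt hY1
  have hm := min_one_sin_pos hY0 hY2
  set V : Set ℂ := {p | |p.im| < Y} ∩ {p | p.re < z.re + 1}
  have hV : V ∈ 𝓝 z := ((isOpen_strip Y).inter
    (isOpen_lt Complex.continuous_re continuous_const)).mem_nhds ⟨hY1, by simp⟩
  have key := intervalIntegral.hasDerivAt_integral_of_dominated_loc_of_deriv_le (𝕜 := ℂ)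
    (μ := volume) (a := 0) (b := 1)
    (F := fun p (t : ℝ) => Complex.log (1 - -Complex.exp p * (t : ℂ)) / (t : ℂ))
    (F' := fun p (t : ℝ) => Complex.exp p / (1 + t * Complex.exp p)) (x₀ := z) (s := V)
    (bound := fun _ => Real.exp (z.re + 1) / min 1 (Real.sin Y)) hV
    (Eventually.of_forall fun p => (by fun_prop : Measurable _).aestronglyMeasurable)
    (intervalIntegrable_dilog hz) (by fun_prop : Measurable _).aestronglyMeasurable
    (Eventually.of_forall fun t ht p hp => ?_) intervalIntegrable_const
    (Eventually.of_forall fun t ht p hp => ?_)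
  · have hint : ∫ t in (0 : ℝ)..1, Complex.exp z / (1 + t * Complex.exp z) =
        Complex.log (1 + Complex.exp z) := by
      rw [intervalIntegral.integral_eq_sub_of_hasDerivAt
        (f := fun t : ℝ => Complex.log (1 + t * Complex.exp z)) ?_ key.1]
      · simp
      · intro t ht
        rw [uIcc_of_le zero_le_one] at ht
        refine HasDerivAt.clog_real ?_ (one_add_mul_exp_mem_slitPlane ht.1 hz)
        simpa using ((Complex.ofRealCLM.hasDerivAt (x := t)).mul_const (Complex.exp z)).const_add 1
    have := key.2.neg
    rw [hint] at this
    exact this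
  · rw [uIoc_of_le zero_le_one] at ht
    rw [norm_div, Complex.norm_exp]
    gcongr
    · exact hp.2.le
    · exact min_one_sin_le_norm_one_add ht.1.le (le_of_lt hp.1) hY2
  · rw [uIoc_of_le zero_le_one] at ht
    have ht0 : (t : ℂ) ≠ 0 := by exact_mod_cast ht.1.ne'
    have h1 := one_add_mul_exp_mem_slitPlane ht.1.le ((show |p.im| < Y from hp.1).trans hY2)
    have h2 : HasDerivAt (fun p => 1 - -Complex.exp p * (t : ℂ)) (t * Complex.exp p) p := by
      simpa [mul_comm] using ((Complex.hasDerivAt_exp p).neg.mul_const (t : ℂ)).const_sub 1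
    have h3 := (h2.clog (by simpa [mul_comm] using h1)).div_const (t : ℂ)
    refine h3.congr_deriv ?_
    rw [show 1 - -Complex.exp p * (t : ℂ) = 1 + t * Complex.exp p by ring]
    field_simp

theorem tendsto_dilog_zero : Tendsto dilog (𝓝 0) (𝓝 0) := by
  have hb : ∀ w : ℂ, ‖w‖ < 1 → ‖dilog w‖ ≤ ‖w‖ * (1 - ‖w‖)⁻¹ := by
    intro w hw
    rw [← (dilog_hasSum hw).tsum_eq]
    refine tsum_of_norm_bounded
      ((hasSum_geometric_of_lt_one (norm_nonneg w) hw).mul_left ‖w‖) fun k => ?_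
    have : (1 : ℝ) ≤ ‖((k : ℂ) + 1) ^ 2‖ := by
      rw [norm_pow]
      refine one_le_pow₀ ?_
      rw [show ((k : ℂ) + 1) = ((k + 1 : ℕ) : ℂ) by push_cast; ring, Complex.norm_natCast]
      exact_mod_cast Nat.succ_le_succ (Nat.zero_le k)
    rw [norm_div, norm_pow, pow_succ']
    exact div_le_self (by positivity) this
  have hlim : Tendsto (fun w : ℂ => ‖w‖ * (1 - ‖w‖)⁻¹) (𝓝 0) (𝓝 0) := by
    have : ContinuousAt (fun w : ℂ => ‖w‖ * (1 - ‖w‖)⁻¹) 0 := by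
      refine ContinuousAt.mul (by fun_prop) (ContinuousAt.inv₀ (by fun_prop) (by simp))
    simpa [ContinuousAt] using this
  refine squeeze_zero_norm' ?_ hlim
  filter_upwards [Metric.ball_mem_nhds (0 : ℂ) one_pos] with w hw
  exact hb w (by simpa using hw)

theorem tendsto_exp_sub_atTop (z : ℂ) :
    Tendsto (fun u : ℝ => Complex.exp (z - u)) atTop (𝓝 0) := by
  rw [tendsto_zero_iff_norm_tendsto_zero]
  simp only [Complex.norm_exp, Complex.sub_re, Complex.ofReal_re]
  exact Real.tendsto_exp_atBot.comp (tendsto_atBot_add_const_left _ _ tendsto_neg_atTop_atBot)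

theorem norm_logistic_sub_le {z : ℂ} {Y u : ℝ} (hY0 : 0 < Y) (hz : |z.im| ≤ Y)
    (hY : Y < Real.pi) :
    ‖logistic (z - u)‖ ≤ Real.exp z.re / min 1 (Real.sin Y) * Real.exp (-u) := by
  have h := min_one_sin_le_norm_one_add (z := z - u) zero_le_one (by simpa using hz) hY
  have hm := min_one_sin_pos hY0 hY
  push_cast at h
  rw [one_mul] at h
  rw [logistic_eq, norm_div, Complex.norm_exp, div_mul_eq_mul_div, ← Real.exp_add]
  gcongr
  simp [sub_eq_add_neg]

theorem continuous_logistic_line {z a : ℂ} (hz : |z.im| < Real.pi) (ha : a.im = 0) :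
    Continuous fun u : ℝ => logistic (z + a * u) := by
  refine continuous_iff_continuousAt.2 fun u => ?_
  exact ContinuousAt.comp (f := fun u : ℝ => z + a * u)
    (differentiableAt_logistic (by simpa [ha] using hz)).continuousAt (by fun_prop)

theorem integrableOn_mul_logistic_sub {z : ℂ} (hz : |z.im| < Real.pi) :
    IntegrableOn (fun u : ℝ => (u : ℂ) * logistic (z - u)) (Ioi 0) := by
  obtain ⟨Y, hY1, hY2⟩ := exists_between hz
  have hY0 : 0 < Y := (abs_nonneg _).trans_lt hY1
  have hm := min_one_sin_pos hY0 hY2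
  set C := Real.exp z.re / min 1 (Real.sin Y)
  have hcont : Continuous fun u : ℝ => (u : ℂ) * logistic (z - u) := by
    have := continuous_logistic_line (a := -1) hz (by simp)
    simp only [neg_mul, one_mul, ← sub_eq_add_neg] at this
    fun_prop
  have hi : IntegrableOn (fun u : ℝ => 2 * C * Real.exp ((-1 / 2) * u)) (Ioi 0) :=
    (integrableOn_exp_mul_Ioi (by norm_num) 0).const_mul _
  refine hi.mono' hcont.aestronglyMeasurable ?_
  refine (ae_restrict_iff' measurableSet_Ioi).2 (Eventually.of_forall fun u (hu : 0 < u) => ?_)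
  rw [norm_mul, Complex.norm_real, Real.norm_of_nonneg hu.le]
  have h1 : u ≤ 2 * Real.exp (u / 2) := by linarith [Real.add_one_le_exp (u / 2)]
  have h2 : Real.exp (u / 2) * Real.exp (-u) = Real.exp ((-1 / 2) * u) := by
    rw [← Real.exp_add]; ring_nf
  calc u * ‖logistic (z - u)‖ ≤ (2 * Real.exp (u / 2)) * (C * Real.exp (-u)) := by
        gcongr
        exact norm_logistic_sub_le hY0 hY1.le hY2
    _ = _ := by rw [← h2]; ring

/-- The dilogarithm as a moment of the logistic function; the integrand is the derivative in `u`
of `Li₂(-exp (z - u)) - u log (1 + exp (z - u))`. -/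
theorem integral_mul_logistic_sub {z : ℂ} (hz : |z.im| < Real.pi) :
    ∫ u in Ioi (0 : ℝ), (u : ℂ) * logistic (z - u) = -dilog (-Complex.exp z) := by
  set H : ℝ → ℂ := fun u =>
    dilog (-Complex.exp (z - u)) - u * Complex.log (1 + Complex.exp (z - u))
  have hd : ∀ u : ℝ, HasDerivAt H (u * logistic (z - u)) u := by
    intro u
    have him : |(z - u).im| < Real.pi := by simpa using hz
    have hl : HasDerivAt (fun u : ℝ => z - (u : ℂ)) (-1) u := by
      simpa using (Complex.ofRealCLM.hasDerivAt (x := u)).const_sub z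
    have h1 : HasDerivAt (fun u : ℝ => dilog (-Complex.exp (z - u)))
        (-Complex.log (1 + Complex.exp (z - u)) * -1) u :=
      HasDerivAt.comp (h₂ := fun z => dilog (-Complex.exp z)) u (hasDerivAt_dilog_neg_exp him) hl
    have h2 : HasDerivAt (fun u : ℝ => Complex.log (1 + Complex.exp (z - u)))
        (logistic (z - u) * -1) u :=
      HasDerivAt.comp (h₂ := fun z => Complex.log (1 + Complex.exp z)) u
        (hasDerivAt_log_one_add_exp him) hl
    have h3 : HasDerivAt (fun u : ℝ => (u : ℂ)) 1 u := by
      simpa using (hasDerivAt_id u).ofReal_comp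
    refine (h1.sub (h3.mul h2)).congr_deriv ?_
    ring
  have hlim : Tendsto H atTop (𝓝 0) := by
    have h1 : Tendsto (fun u : ℝ => dilog (-Complex.exp (z - u))) atTop (𝓝 0) := by
      refine tendsto_dilog_zero.comp ?_
      simpa using (tendsto_exp_sub_atTop z).neg
    have h2 : Tendsto (fun u : ℝ => (u : ℂ) * Complex.log (1 + Complex.exp (z - u))) atTop
        (𝓝 0) := by
      have h3 : Tendsto (fun u : ℝ => (3 / 2 * Real.exp z.re) * (u ^ 1 * Real.exp (-u))) atTop
          (𝓝 0) := by
        simpa using (Real.tendsto_pow_mul_exp_neg_atTop_nhds_zero 1).const_mul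
          (3 / 2 * Real.exp z.re)
      refine squeeze_zero_norm' ?_ h3
      have h4 : ∀ᶠ u : ℝ in atTop, ‖Complex.exp (z - u)‖ ≤ 1 / 2 := by
        have := (tendsto_exp_sub_atTop z).norm
        rw [norm_zero] at this
        exact (this.eventually (gt_mem_nhds (by norm_num : (0 : ℝ) < 1 / 2))).mono fun _ h => h.le
      filter_upwards [h4, eventually_ge_atTop 0] with u hu hu0
      rw [norm_mul, Complex.norm_real, Real.norm_of_nonneg hu0]
      have h5 := Complex.norm_log_one_add_half_le_self hu
      have h6 : ‖Complex.exp (z - u)‖ = Real.exp z.re * Real.exp (-u) := by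
        rw [Complex.norm_exp, ← Real.exp_add]; simp [sub_eq_add_neg]
      rw [h6] at h5
      nlinarith
    simpa using h1.sub h2
  rw [integral_Ioi_of_hasDerivAt_of_tendsto' (fun u _ => hd u) (integrableOn_mul_logistic_sub hz)
    hlim]
  simp [H]

theorem iteratedDeriv_dilog_neg_exp {z : ℂ} (hz : |z.im| < Real.pi) (m : ℕ) :
    iteratedDeriv (m + 2) (fun u => dilog (-Complex.exp u)) z = -iteratedDeriv m logistic z := by
  have hmem : {z : ℂ | |z.im| < Real.pi} ∈ 𝓝 z := (isOpen_strip _).mem_nhds hz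
  have h1 : deriv (fun u => dilog (-Complex.exp u)) =ᶠ[𝓝 z]
      fun z => -Complex.log (1 + Complex.exp z) := by
    filter_upwards [hmem] with p hp using (hasDerivAt_dilog_neg_exp hp).deriv
  have h2 : deriv (fun z => -Complex.log (1 + Complex.exp z)) =ᶠ[𝓝 z] -logistic := by
    filter_upwards [hmem] with p hp using (hasDerivAt_log_one_add_exp hp).neg.deriv
  rw [iteratedDeriv_succ', h1.iteratedDeriv_eq, iteratedDeriv_succ', h2.iteratedDeriv_eq,
    iteratedDeriv_neg]

/-! ### Derivatives of the logistic function -/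

theorem analyticOnNhd_iteratedDeriv_logistic (m : ℕ) :
    AnalyticOnNhd ℂ (iteratedDeriv m logistic) {z | |z.im| < Real.pi} := by
  rw [iteratedDeriv_eq_iterate]
  exact (DifferentiableOn.analyticOnNhd
    (fun z hz => (differentiableAt_logistic hz).differentiableWithinAt)
    (isOpen_strip _)).iterated_deriv m

theorem hasDerivAt_iteratedDeriv_logistic {z : ℂ} (hz : |z.im| < Real.pi) (m : ℕ) :
    HasDerivAt (iteratedDeriv m logistic) (iteratedDeriv (m + 1) logistic z) z := by
  rw [iteratedDeriv_succ]
  exact (analyticOnNhd_iteratedDeriv_logistic m z hz).differentiableAt.hasDerivAt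

/-- Cauchy's estimate on a disc of radius `δ` that stays in the strip `|Im s| ≤ y + δ`. -/
theorem norm_iteratedDeriv_logistic_le {z : ℂ} {y δ : ℝ} (hz : |z.im| ≤ y) (hδ : 0 < δ)
    (hy : y + δ < Real.pi) (m : ℕ) :
    ‖iteratedDeriv m logistic z‖ ≤
      m.factorial * max 1 (1 / Real.sin (y + δ)) / δ ^ m := by
  have him : ∀ s ∈ Metric.closedBall z δ, |s.im| ≤ y + δ := by
    intro s hs
    have h1 : |(s - z).im| ≤ δ := (Complex.abs_im_le_norm _).trans (by
      rwa [Metric.mem_closedBall, dist_eq_norm] at hs)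
    calc |s.im| = |z.im + (s - z).im| := by simp
      _ ≤ |z.im| + |(s - z).im| := abs_add_le _ _
      _ ≤ _ := add_le_add hz h1
  have hy0 : 0 ≤ y := (abs_nonneg _).trans hz
  refine Complex.norm_iteratedDeriv_le_of_forall_mem_sphere_norm_le m hδ ?_ fun s hs =>
    norm_logistic_le (by linarith) (him s (Metric.sphere_subset_closedBall hs)) hy
  refine DifferentiableOn.diffContOnCl fun s hs => ?_
  rw [closure_ball _ hδ.ne'] at hs
  exact (differentiableAt_logistic ((him s hs).trans_lt hy)).differentiableWithinAt

/-! ### Laplace integrals of the logistic function -/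

theorem integrableOn_exp_neg_mul_const {r : ℝ} (hr : 0 < r) (C : ℝ) :
    IntegrableOn (fun v : ℝ => C * Real.exp (-r * v)) (Ioi 0) :=
  (integrableOn_exp_mul_Ioi (by linarith) 0).const_mul _

theorem norm_exp_neg_mul_mul_le {κ w : ℂ} {C v : ℝ} (hw : ‖w‖ ≤ C) :
    ‖Complex.exp (-(κ * v)) * w‖ ≤ C * Real.exp (-κ.re * v) := by
  rw [norm_mul, Complex.norm_exp, mul_comm]
  simp only [Complex.neg_re, Complex.re_mul_ofReal, neg_mul]
  gcongr

theorem integrableOn_laplace {κ : ℂ} (hκ : 0 < κ.re) {g : ℝ → ℂ} {C : ℝ} (hg : Continuous g)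
    (hC : ∀ v, ‖g v‖ ≤ C) :
    IntegrableOn (fun v : ℝ => Complex.exp (-(κ * v)) * g v) (Ioi 0) :=
  (integrableOn_exp_neg_mul_const hκ C).mono'
    (by fun_prop : Continuous fun v : ℝ => Complex.exp (-(κ * v)) * g v).aestronglyMeasurable
    (Eventually.of_forall fun v => norm_exp_neg_mul_mul_le (hC v))

theorem norm_laplace_le {κ : ℂ} (hκ : 0 < κ.re) {g : ℝ → ℂ} {C : ℝ} (hC : ∀ v, ‖g v‖ ≤ C) :
    ‖∫ v in Ioi (0 : ℝ), Complex.exp (-(κ * v)) * g v‖ ≤ C / κ.re := by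
  refine (norm_integral_le_of_norm_le (integrableOn_exp_neg_mul_const hκ C)
    (Eventually.of_forall fun v => norm_exp_neg_mul_mul_le (hC v))).trans_eq ?_
  rw [integral_const_mul, integral_exp_mul_Ioi (by linarith)]
  simp [div_eq_mul_inv]

/-- Integration by parts in a Laplace integral. -/
theorem laplace_eq_add_laplace_deriv {κ : ℂ} (hκ : 0 < κ.re) {g g' : ℝ → ℂ} {C C' : ℝ}
    (hd : ∀ v, HasDerivAt g (g' v) v) (hg' : Continuous g') (hC : ∀ v, ‖g v‖ ≤ C)
    (hC' : ∀ v, ‖g' v‖ ≤ C') :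
    ∫ v in Ioi (0 : ℝ), Complex.exp (-(κ * v)) * g v =
      κ⁻¹ * g 0 + κ⁻¹ * ∫ v in Ioi (0 : ℝ), Complex.exp (-(κ * v)) * g' v := by
  have hκ0 : κ ≠ 0 := by rintro rfl; simp at hκ
  have hg : Continuous g := continuous_iff_continuousAt.2 fun v => (hd v).continuousAt
  have hder : ∀ v : ℝ, HasDerivAt (fun v : ℝ => -κ⁻¹ * (Complex.exp (-(κ * v)) * g v))
      (Complex.exp (-(κ * v)) * g v - κ⁻¹ * (Complex.exp (-(κ * v)) * g' v)) v := by
    intro v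
    have h1 : HasDerivAt (fun v : ℝ => -(κ * (v : ℂ))) (-κ) v := by
      simpa using ((hasDerivAt_id v).ofReal_comp.const_mul κ).fun_neg
    refine ((h1.cexp.mul (hd v)).const_mul (-κ⁻¹)).congr_deriv ?_
    field_simp
    ring
  have hlim : Tendsto (fun v : ℝ => -κ⁻¹ * (Complex.exp (-(κ * v)) * g v)) atTop (𝓝 0) := by
    have h1 : Tendsto (fun v : ℝ => C * Real.exp (-κ.re * v)) atTop (𝓝 0) := by
      have : Tendsto (fun v : ℝ => -κ.re * v) atTop atBot :=
        tendsto_id.const_mul_atTop_of_neg (by linarith)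
      simpa using (Real.tendsto_exp_atBot.comp this).const_mul C
    simpa using (squeeze_zero_norm (fun v => norm_exp_neg_mul_mul_le (hC v)) h1).const_mul (-κ⁻¹)
  have i1 := integrableOn_laplace hκ hg hC
  have i2 := (integrableOn_laplace hκ hg' hC').const_mul κ⁻¹
  have := integral_Ioi_of_hasDerivAt_of_tendsto' (fun v _ => hder v) (i1.sub i2) hlim
  rw [integral_sub i1 i2, integral_const_mul] at this
  simp only [Complex.ofReal_zero, mul_zero, neg_zero, Complex.exp_zero, one_mul, zero_sub] at this
  linear_combination this

/-- The Laplace transform at `κ` of the even function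
`v ↦ σ⁽ʲ⁾(z + a v) + σ⁽ʲ⁾(z - a v)`, where `σ` is the logistic function. -/
noncomputable def logisticLaplace (κ z : ℂ) (a : ℝ) (j : ℕ) : ℂ :=
  ∫ v in Ioi (0 : ℝ), Complex.exp (-(κ * v)) *
    (iteratedDeriv j logistic (z + a * v) + iteratedDeriv j logistic (z - a * v))

theorem exists_norm_iteratedDeriv_logistic_line_le {z : ℂ} (hz : |z.im| < Real.pi) (j : ℕ) :
    ∃ C, ∀ s : ℂ, s.im = z.im → ‖iteratedDeriv j logistic s‖ ≤ C :=
  ⟨_, fun s hs => norm_iteratedDeriv_logistic_le (y := |z.im|) (δ := (Real.pi - |z.im|) / 2)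
    (by rw [hs]) (by linarith) (by linarith) j⟩

theorem hasDerivAt_iteratedDeriv_logistic_line {z : ℂ} (hz : |z.im| < Real.pi) (a : ℝ) (j : ℕ)
    (v : ℝ) :
    HasDerivAt (fun v : ℝ => iteratedDeriv j logistic (z + a * v))
      (a * iteratedDeriv (j + 1) logistic (z + a * v)) v := by
  have h1 : HasDerivAt (fun v : ℝ => z + a * (v : ℂ)) a v := by
    simpa using ((hasDerivAt_id v).ofReal_comp.const_mul (a : ℂ)).const_add z
  have h2 := HasDerivAt.comp (h₂ := iteratedDeriv j logistic) v
    (hasDerivAt_iteratedDeriv_logistic (z := z + a * v) (by simpa using hz) j) h1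
  exact h2.congr_deriv (mul_comm _ _)

theorem continuous_iteratedDeriv_logistic_line {z : ℂ} (hz : |z.im| < Real.pi) (a : ℝ) (j : ℕ) :
    Continuous fun v : ℝ => iteratedDeriv j logistic (z + a * v) :=
  continuous_iff_continuousAt.2 fun v =>
    (hasDerivAt_iteratedDeriv_logistic_line hz a j v).continuousAt

/-- Two integrations by parts; the boundary term of the second one vanishes by parity. -/
theorem logisticLaplace_eq_add {κ z : ℂ} (hκ : 0 < κ.re) (hz : |z.im| < Real.pi) (a : ℝ) (j : ℕ) :
    logisticLaplace κ z a j = 2 * κ⁻¹ * iteratedDeriv j logistic z +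
      κ⁻¹ ^ 2 * a ^ 2 * logisticLaplace κ z a (j + 2) := by
  set s : ℕ → ℝ → ℝ → ℂ := fun j a v => iteratedDeriv j logistic (z + a * v) with hs
  have hd : ∀ j a v, HasDerivAt (s j a) (a * s (j + 1) a v) v := fun j a v =>
    hasDerivAt_iteratedDeriv_logistic_line hz a j v
  have hc : ∀ j a, Continuous (s j a) := fun j a => continuous_iteratedDeriv_logistic_line hz a j
  choose C hC using exists_norm_iteratedDeriv_logistic_line_le hz
  have hb : ∀ j a v, ‖s j a v‖ ≤ C j := fun j a v => hC j _ (by simp)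
  have h1 := laplace_eq_add_laplace_deriv hκ (g := fun v => s j a v + s j (-a) v)
    (g' := fun v => a * s (j + 1) a v + (-a : ℝ) * s (j + 1) (-a) v) (C := C j + C j)
    (C' := ‖(a : ℂ)‖ * C (j + 1) + ‖((-a : ℝ) : ℂ)‖ * C (j + 1))
    (fun v => (hd j a v).add (hd j (-a) v))
    (((hc _ _).const_mul _).add ((hc _ _).const_mul _))
    (fun v => norm_add_le_of_le (hb _ _ _) (hb _ _ _))
    (fun v => norm_add_le_of_le (norm_mul_le_of_le le_rfl (hb _ _ _))
      (norm_mul_le_of_le le_rfl (hb _ _ _)))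
  have h2 := laplace_eq_add_laplace_deriv hκ
    (g := fun v => a * s (j + 1) a v + (-a : ℝ) * s (j + 1) (-a) v)
    (g' := fun v => a * (a * s (j + 2) a v) + (-a : ℝ) * ((-a : ℝ) * s (j + 2) (-a) v))
    (C' := ‖(a : ℂ)‖ * (‖(a : ℂ)‖ * C (j + 2)) +
      ‖((-a : ℝ) : ℂ)‖ * (‖((-a : ℝ) : ℂ)‖ * C (j + 2)))
    (fun v => ((hd (j + 1) a v).const_mul _).add ((hd (j + 1) (-a) v).const_mul _))
    ((((hc _ _).const_mul _).const_mul _).add (((hc _ _).const_mul _).const_mul _))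
    (fun v => norm_add_le_of_le (norm_mul_le_of_le le_rfl (hb _ _ _))
      (norm_mul_le_of_le le_rfl (hb _ _ _)))
    (fun v => norm_add_le_of_le (norm_mul_le_of_le le_rfl (norm_mul_le_of_le le_rfl (hb _ _ _)))
      (norm_mul_le_of_le le_rfl (norm_mul_le_of_le le_rfl (hb _ _ _))))
  have h3 : ∫ v in Ioi (0 : ℝ), Complex.exp (-(κ * v)) *
      (a * (a * s (j + 2) a v) + (-a : ℝ) * ((-a : ℝ) * s (j + 2) (-a) v)) =
      a ^ 2 * logisticLaplace κ z a (j + 2) := by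
    rw [logisticLaplace, ← integral_const_mul]
    congr 1 with v
    simp only [hs]
    push_cast
    rw [show z + -(a : ℂ) * v = z - a * v by ring]
    ring
  have h4 : logisticLaplace κ z a j =
      ∫ v in Ioi (0 : ℝ), Complex.exp (-(κ * v)) * (s j a v + s j (-a) v) := by
    rw [logisticLaplace]
    congr 1 with v
    simp only [hs]
    push_cast
    rw [show z + -(a : ℂ) * v = z - a * v by ring]
  rw [h4, h1, h2, h3]
  simp only [hs]
  push_cast
  simp only [mul_zero, add_zero]
  ring

theorem logisticLaplace_zero_eq_sum {κ z : ℂ} (hκ : 0 < κ.re) (hz : |z.im| < Real.pi) (a : ℝ)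
    (N : ℕ) :
    logisticLaplace κ z a 0 =
      ∑ j ∈ Finset.range N, 2 * κ⁻¹ ^ (2 * j + 1) * a ^ (2 * j) * iteratedDeriv (2 * j) logistic z +
      κ⁻¹ ^ (2 * N) * a ^ (2 * N) * logisticLaplace κ z a (2 * N) := by
  induction N with
  | zero => simp
  | succ N ih =>
    rw [ih, Finset.sum_range_succ, logisticLaplace_eq_add hκ hz a (2 * N),
      show 2 * (N + 1) = 2 * N + 2 by ring]
    ring

theorem norm_logisticLaplace_le {κ z : ℂ} (hκ : 0 < κ.re) {j : ℕ} {C : ℝ}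
    (hC : ∀ s : ℂ, s.im = z.im → ‖iteratedDeriv j logistic s‖ ≤ C) (a : ℝ) :
    ‖logisticLaplace κ z a j‖ ≤ 2 * C / κ.re := by
  refine norm_laplace_le hκ fun v => ?_
  rw [two_mul]
  exact norm_add_le_of_le (hC _ (by simp)) (hC _ (by simp))

/-! ### The expansion -/

/-- The values `η(2m)` of the alternating zeta function in terms of `B_{2m}(1/2)`. -/
theorem hasSum_alternating_zeta_even (m : ℕ) :
    HasSum (fun k : ℕ => (-1 : ℂ) ^ k / ((k : ℂ) + 1) ^ (2 * m + 2))
      (-((-1 : ℂ) ^ m * (2 * Real.pi) ^ (2 * m + 2) / 2 / (2 * m + 2).factorial *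
        (((Polynomial.bernoulli (2 * m + 2)).eval (1 / 2 : ℚ) : ℚ) : ℂ))) := by
  have h := hasSum_one_div_nat_pow_mul_cos (k := m + 1) (by omega) (x := 1 / 2)
    ⟨by norm_num, by norm_num⟩
  rw [← hasSum_nat_add_iff' 1] at h
  have h2 := (Complex.hasSum_ofReal.2 h).neg
  have hB : (Polynomial.map (algebraMap ℚ ℝ) (Polynomial.bernoulli (2 * m + 2))).eval (1 / 2) =
      (((Polynomial.bernoulli (2 * m + 2)).eval (1 / 2 : ℚ) : ℚ) : ℝ) := by
    rw [show (1 / 2 : ℝ) = algebraMap ℚ ℝ (1 / 2) by simp, Polynomial.eval_map_algebraMap,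
      Polynomial.aeval_algebraMap_apply]
    simp
  rw [show 2 * (m + 1) = 2 * m + 2 by ring, hB] at h2
  convert! h2 using 1
  · funext k
    have hcos : Real.cos (2 * Real.pi * ((k + 1 : ℕ) : ℝ) * (1 / 2)) = (-1) ^ (k + 1) := by
      rw [← Real.cos_nat_mul_pi]
      ring_nf
    rw [hcos]
    push_cast
    ring
  · simp only [Finset.range_one, Finset.sum_singleton]
    push_cast
    rw [zero_pow (by omega)]
    ring

/-- The closed form `κ Li₂(-exp z) / (2πi)` plus a superposition of Laplace integrals of the
logistic function, where `κ = 1 / b²`; it represents `log Φ_b (z / (2πb))` on the strip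
`|Im z| < π`. -/
noncomputable def laplaceLogDilog (κ z : ℂ) : ℂ :=
  κ / (2 * Real.pi * Complex.I) * dilog (-Complex.exp z) +
    Complex.I / (2 * Real.pi) * ∑' k : ℕ, (-1 : ℂ) ^ k / ((k : ℂ) + 1) ^ 2 *
      logisticLaplace κ z (1 / ((k : ℝ) + 1)) 0

theorem norm_natCast_add_one (k : ℕ) : ‖((k : ℂ) + 1)‖ = (k : ℝ) + 1 := by
  rw [show ((k : ℂ) + 1) = ((k + 1 : ℕ) : ℂ) by push_cast; ring, Complex.norm_natCast]
  push_cast; ring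

theorem hasSum_inv_succ_sq : HasSum (fun k : ℕ => 1 / ((k : ℝ) + 1) ^ 2) (Real.pi ^ 2 / 6) := by
  have := (hasSum_nat_add_iff' 1).2 hasSum_zeta_two
  simpa using this

theorem norm_alternating_term_le (k m : ℕ) :
    ‖(-1 : ℂ) ^ k / ((k : ℂ) + 1) ^ (m + 2)‖ ≤ 1 / ((k : ℝ) + 1) ^ 2 := by
  rw [norm_div, norm_pow, norm_neg, norm_one, one_pow, norm_pow, norm_natCast_add_one]
  have : (0 : ℝ) ≤ k := k.cast_nonneg
  gcongr
  · linarith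
  · omega

theorem asympTerm_zero (τ z : ℂ) :
    asympTerm τ z 0 = τ⁻¹ / (2 * Real.pi * Complex.I) * dilog (-Complex.exp z) := by
  simp only [asympTerm, CharP.cast_eq_zero, mul_zero, zero_sub, zpow_neg_one, iteratedDeriv_zero,
    Polynomial.bernoulli_zero, Polynomial.eval_one, Nat.factorial_zero]
  push_cast
  ring

theorem asympTerm_succ {τ z : ℂ} (hz : |z.im| < Real.pi) (m : ℕ) :
    asympTerm τ z (m + 1) = Complex.I / (2 * Real.pi) *
      (2 * τ ^ (2 * m + 1) * iteratedDeriv (2 * m) logistic z *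
        ∑' k : ℕ, (-1 : ℂ) ^ k / ((k : ℂ) + 1) ^ (2 * m + 2)) := by
  have hexp : 2 * ((m + 1 : ℕ) : ℤ) - 1 = ((2 * m + 1 : ℕ) : ℤ) := by push_cast; ring
  have hI : (2 * Real.pi * Complex.I) ^ (2 * m + 1) =
      (2 * Real.pi : ℂ) ^ (2 * m + 1) * (-1) ^ m * Complex.I := by
    rw [mul_pow, pow_succ Complex.I, pow_mul, Complex.I_sq]
    ring
  have hpi : (Real.pi : ℂ) ≠ 0 := by exact_mod_cast Real.pi_ne_zero
  have hf : ((2 * m + 2).factorial : ℂ) ≠ 0 := by exact_mod_cast Nat.factorial_ne_zero _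
  rw [(hasSum_alternating_zeta_even m).tsum_eq, asympTerm, hexp, zpow_natCast, zpow_natCast, hI,
    show 2 * (m + 1) = 2 * m + 2 by ring, iteratedDeriv_dilog_neg_exp hz]
  field_simp
  ring

/-- The `N`-th remainder of the expansion, again a superposition of Laplace integrals. -/
theorem laplaceLogDilog_sub_sum {τ z : ℂ} (hτ : 0 < (τ⁻¹).re) (hz : |z.im| < Real.pi) (N : ℕ) :
    laplaceLogDilog τ⁻¹ z - ∑ n ∈ Finset.range (N + 1), asympTerm τ z n =
      Complex.I / (2 * Real.pi) * (τ ^ (2 * N) *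
        ∑' k : ℕ, (-1 : ℂ) ^ k / ((k : ℂ) + 1) ^ (2 * N + 2) *
          logisticLaplace τ⁻¹ z (1 / ((k : ℝ) + 1)) (2 * N)) := by
  obtain ⟨C, hC⟩ := exists_norm_iteratedDeriv_logistic_line_le hz (2 * N)
  have hsum : Summable fun k : ℕ => (-1 : ℂ) ^ k / ((k : ℂ) + 1) ^ (2 * N + 2) *
      logisticLaplace τ⁻¹ z (1 / ((k : ℝ) + 1)) (2 * N) :=
    (hasSum_inv_succ_sq.summable.mul_right (2 * C / (τ⁻¹).re)).of_norm_bounded fun k =>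
      norm_mul_le_of_le (norm_alternating_term_le k _) (norm_logisticLaplace_le hτ hC _)
  have hfin : HasSum (fun k : ℕ => ∑ j ∈ Finset.range N,
      2 * τ ^ (2 * j + 1) * iteratedDeriv (2 * j) logistic z *
        ((-1 : ℂ) ^ k / ((k : ℂ) + 1) ^ (2 * j + 2)))
      (∑ j ∈ Finset.range N, 2 * τ ^ (2 * j + 1) * iteratedDeriv (2 * j) logistic z *
        ∑' k : ℕ, (-1 : ℂ) ^ k / ((k : ℂ) + 1) ^ (2 * j + 2)) :=
    hasSum_sum fun j _ => ((hasSum_alternating_zeta_even j).summable.hasSum).mul_left _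
  have hterm : ∀ k : ℕ, (-1 : ℂ) ^ k / ((k : ℂ) + 1) ^ 2 *
      logisticLaplace τ⁻¹ z (1 / ((k : ℝ) + 1)) 0 =
      ∑ j ∈ Finset.range N, 2 * τ ^ (2 * j + 1) * iteratedDeriv (2 * j) logistic z *
        ((-1 : ℂ) ^ k / ((k : ℂ) + 1) ^ (2 * j + 2)) +
      τ ^ (2 * N) * ((-1 : ℂ) ^ k / ((k : ℂ) + 1) ^ (2 * N + 2) *
        logisticLaplace τ⁻¹ z (1 / ((k : ℝ) + 1)) (2 * N)) := by
    intro k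
    have hk : ((k : ℂ) + 1) ≠ 0 := by exact_mod_cast Nat.succ_ne_zero k
    rw [logisticLaplace_zero_eq_sum hτ hz _ N, mul_add, Finset.mul_sum, inv_inv]
    congr 1
    · refine Finset.sum_congr rfl fun j _ => ?_
      push_cast
      rw [div_pow, one_pow, pow_add _ (2 * j) 2]
      field_simp
    · push_cast
      rw [div_pow, one_pow, pow_add _ (2 * N) 2]
      field_simp
  rw [laplaceLogDilog, tsum_congr hterm, (hfin.add (hsum.hasSum.mul_left (τ ^ (2 * N)))).tsum_eq,
    Finset.sum_range_succ', asympTerm_zero, Finset.sum_congr rfl fun m _ => asympTerm_succ hz m,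
    ← Finset.mul_sum]
  ring

/-- The remainder estimate; the proof gives it with the smaller constant
`π / 6 * max 1 (1 / sin (|Im z| + δ))` in place of `L` and `1 / δ` in place of `M`. -/
theorem norm_laplaceLogDilog_sub_sum_le {τ z : ℂ} (hτ : 0 < τ.re) {δ : ℝ} (hδ : 0 < δ)
    (hz : |z.im| < Real.pi - δ) (N : ℕ) :
    ‖laplaceLogDilog τ⁻¹ z - ∑ n ∈ Finset.range (N + 1), asympTerm τ z n‖ ≤
      max 2 (Real.pi ^ 2 / (3 * Real.sin (|z.im| + δ))) * (2 / δ) ^ (2 * N) *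
        (Nat.factorial (2 * N) : ℝ) * (‖τ‖ ^ 2 / τ.re) * ‖τ‖ ^ (2 * N) := by
  have hτ0 : τ ≠ 0 := by rintro rfl; simp at hτ
  have hre : (τ⁻¹).re = τ.re / ‖τ‖ ^ 2 := by rw [Complex.inv_re, Complex.sq_norm]
  have hτn : 0 < ‖τ‖ := norm_pos_iff.2 hτ0
  have hκ : 0 < (τ⁻¹).re := by rw [hre]; positivity
  have hzpi : |z.im| < Real.pi := by linarith
  have hs : 0 < Real.sin (|z.im| + δ) :=
    Real.sin_pos_of_pos_of_lt_pi (by positivity) (by linarith)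
  set K := max 1 (1 / Real.sin (|z.im| + δ))
  set C := (2 * N).factorial * K / δ ^ (2 * N)
  have hC : ∀ s : ℂ, s.im = z.im → ‖iteratedDeriv (2 * N) logistic s‖ ≤ C := fun s h =>
    norm_iteratedDeriv_logistic_le (by rw [h]) hδ (by linarith) _
  have hpi := Real.pi_pos
  have hK : 0 < K := lt_max_of_lt_left one_pos
  have hsum : ‖∑' k : ℕ, (-1 : ℂ) ^ k / ((k : ℂ) + 1) ^ (2 * N + 2) *
      logisticLaplace τ⁻¹ z (1 / ((k : ℝ) + 1)) (2 * N)‖ ≤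
      Real.pi ^ 2 / 6 * (2 * C / (τ⁻¹).re) :=
    tsum_of_norm_bounded (hasSum_inv_succ_sq.mul_right _) fun k =>
      norm_mul_le_of_le (norm_alternating_term_le k _) (norm_logisticLaplace_le hκ hC _)
  have hI : ‖Complex.I / (2 * Real.pi)‖ = 1 / (2 * Real.pi) := by
    simp [abs_of_pos hpi]
  have hKL : Real.pi / 6 * K ≤ max 2 (Real.pi ^ 2 / (3 * Real.sin (|z.im| + δ))) := by
    rcases max_choice 1 (1 / Real.sin (|z.im| + δ)) with h | h
    · refine le_max_of_le_left ?_
      simp only [K, h]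
      linarith [Real.pi_le_four]
    · refine le_max_of_le_right ?_
      simp only [K, h]
      rw [div_mul_div_comm, mul_one, div_le_div_iff₀ (by positivity) (by positivity)]
      have : Real.pi * 3 ≤ Real.pi ^ 2 * 6 := by nlinarith [Real.pi_gt_three]
      nlinarith
  have hδN : 1 / δ ^ (2 * N) ≤ (2 / δ) ^ (2 * N) := by
    rw [div_pow]
    gcongr
    exact one_le_pow₀ (by norm_num)
  rw [laplaceLogDilog_sub_sum hκ hzpi, norm_mul, norm_mul, norm_pow, hI]
  calc 1 / (2 * Real.pi) * (‖τ‖ ^ (2 * N) * _) ≤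
        1 / (2 * Real.pi) * (‖τ‖ ^ (2 * N) * (Real.pi ^ 2 / 6 * (2 * C / (τ⁻¹).re))) := by
        gcongr
    _ = (Real.pi / 6 * K) * (1 / δ ^ (2 * N)) * (2 * N).factorial * (‖τ‖ ^ 2 / τ.re) *
        ‖τ‖ ^ (2 * N) := by
        simp only [C, hre]
        field_simp
    _ ≤ _ := by gcongr

/-! ### Fourier integrals of hyperbolic functions -/

theorem logistic_ofReal (v : ℝ) : logistic v = (Real.sigmoid v : ℂ) := by
  rw [logistic, Real.sigmoid_def]
  push_cast
  rw [one_div]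

theorem sigmoid_le_exp (v : ℝ) : Real.sigmoid v ≤ Real.exp v := by
  rw [Real.sigmoid_def, inv_le_comm₀ (by positivity) (Real.exp_pos _), ← Real.exp_neg]
  linarith

/-- The substitution `x = σ(v)` turns this integral into the Beta integral `B(1 - q, q)`. -/
theorem integral_logistic_mul_exp {q : ℂ} (h0 : 0 < q.re) (h1 : q.re < 1) :
    ∫ v : ℝ, logistic v * Complex.exp (-(q * v)) = Real.pi / Complex.sin (Real.pi * q) := by
  have hB : Complex.betaIntegral (1 - q) q = Real.pi / Complex.sin (Real.pi * q) := by
    have := Complex.Gamma_mul_Gamma_eq_betaIntegral (s := 1 - q) (t := q) (by simpa using h1) h0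
    rw [sub_add_cancel, Complex.Gamma_one, one_mul, mul_comm, Complex.Gamma_mul_Gamma_one_sub]
      at this
    exact this.symm
  rw [← hB, Complex.betaIntegral, intervalIntegral.integral_of_le zero_le_one,
    ← integral_Ioc_eq_integral_Ioo.symm, ← Real.range_sigmoid, ← image_univ,
    integral_image_eq_integral_abs_deriv_smul MeasurableSet.univ
      (fun v _ => (Real.hasDerivAt_sigmoid v).hasDerivWithinAt) Real.sigmoid_injective.injOn,
    setIntegral_univ]
  congr 1 with v
  have hs := Real.sigmoid_pos v
  have hs1 : 0 < 1 - Real.sigmoid v := sub_pos.2 (Real.sigmoid_lt_one v)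
  have e0 : Real.exp (-v) = (1 - Real.sigmoid v) / Real.sigmoid v := by
    rw [← Real.sigmoid_neg, ← Real.sigmoid_mul_rexp_neg]
    field_simp
  have e1 : Complex.exp (-(q * v)) =
      (Real.sigmoid v : ℂ) ^ (-q) * ((1 - Real.sigmoid v : ℝ) : ℂ) ^ q := by
    have hlog : -v = Real.log (1 - Real.sigmoid v) - Real.log (Real.sigmoid v) := by
      rw [← Real.log_div hs1.ne' hs.ne', ← e0, Real.log_exp]
    rw [Complex.cpow_def_of_ne_zero (by exact_mod_cast hs.ne'),
      Complex.cpow_def_of_ne_zero (by exact_mod_cast hs1.ne'), ← Complex.exp_add,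
      ← Complex.ofReal_log hs.le, ← Complex.ofReal_log hs1.le]
    congr 1
    have : -(v : ℂ) = Real.log (1 - Real.sigmoid v) - Real.log (Real.sigmoid v) := by
      exact_mod_cast hlog
    linear_combination q * this
  rw [logistic_ofReal, e1, abs_of_pos (mul_pos hs hs1), Complex.real_smul,
    show (1 : ℂ) - q - 1 = -q by ring, Complex.cpow_sub _ _ (by
      rw [← Complex.ofReal_one, ← Complex.ofReal_sub]; exact_mod_cast hs1.ne'), Complex.cpow_one]
  have : (1 - (Real.sigmoid v : ℂ)) ≠ 0 := by
    rw [← Complex.ofReal_one, ← Complex.ofReal_sub]; exact_mod_cast hs1.ne'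
  push_cast
  field_simp

theorem norm_logistic_mul_exp_le {q : ℂ} (h0 : 0 < q.re) (v : ℝ) :
    ‖logistic v * Complex.exp (-(q * v))‖ ≤ Real.exp (-(min (q.re / 2) (1 - q.re) * |v|)) := by
  rw [logistic_ofReal, norm_mul, Complex.norm_real, Real.norm_of_nonneg (Real.sigmoid_nonneg v),
    Complex.norm_exp]
  simp only [Complex.neg_re, Complex.re_mul_ofReal]
  rcases le_total 0 v with hv | hv
  · refine (mul_le_of_le_one_left (Real.exp_pos _).le (Real.sigmoid_le_one v)).trans ?_
    rw [abs_of_nonneg hv]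
    have := min_le_left (q.re / 2) (1 - q.re)
    gcongr
    linarith
  · refine (mul_le_mul_of_nonneg_right (sigmoid_le_exp v) (Real.exp_pos _).le).trans ?_
    rw [abs_of_nonpos hv, ← Real.exp_add]
    have := min_le_right (q.re / 2) (1 - q.re)
    gcongr
    nlinarith

theorem log_one_add_exp_ofReal (v : ℝ) :
    Complex.log (1 + Complex.exp v) = (Real.log (1 + Real.exp v) : ℂ) := by
  rw [Complex.ofReal_log (by positivity)]
  push_cast
  rfl

/-- Exponential decay in both directions: `log (1 + exp v)` is at most `exp v` for `v ≤ 0` and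
grows only linearly for `v ≥ 0`. -/
theorem norm_log_one_add_exp_mul_exp_le {q : ℂ} (h0 : 0 < q.re) (h1 : q.re < 1) (v : ℝ) :
    ‖Complex.log (1 + Complex.exp v) * Complex.exp (-(q * v))‖ ≤
      2 / q.re * Real.exp (-(min (q.re / 2) (1 - q.re) * |v|)) := by
  have hL0 : 0 ≤ Real.log (1 + Real.exp v) := Real.log_nonneg (by linarith [Real.exp_pos v])
  rw [log_one_add_exp_ofReal, norm_mul, Complex.norm_real, Real.norm_of_nonneg hL0,
    Complex.norm_exp]
  simp only [Complex.neg_re, Complex.re_mul_ofReal]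
  rcases le_total 0 v with hv | hv
  · have h2 : Real.log (1 + Real.exp v) ≤ 1 + v := by
      rw [Real.log_le_iff_le_exp (by positivity), Real.exp_add]
      have := Real.one_le_exp hv
      nlinarith [Real.exp_one_gt_d9]
    have h3 : 1 + v ≤ 2 / q.re * Real.exp (q.re / 2 * v) := by
      have := Real.add_one_le_exp (q.re / 2 * v)
      rw [div_mul_eq_mul_div, le_div_iff₀ h0]
      nlinarith
    calc _ ≤ 2 / q.re * Real.exp (q.re / 2 * v) * Real.exp (-(q.re * v)) := by
          gcongr; exact h2.trans h3
      _ = 2 / q.re * Real.exp (-(q.re / 2 * v)) := by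
          rw [mul_assoc, ← Real.exp_add]; ring_nf
      _ ≤ _ := by
          rw [abs_of_nonneg hv]
          gcongr
          exact min_le_left _ _
  · have h2 : Real.log (1 + Real.exp v) ≤ Real.exp v := by
      have := Real.log_le_sub_one_of_pos (x := 1 + Real.exp v) (by positivity)
      linarith
    have h3 : (1 : ℝ) ≤ 2 / q.re := by rw [le_div_iff₀ h0]; linarith
    calc _ ≤ 1 * (Real.exp v * Real.exp (-(q.re * v))) := by rw [one_mul]; gcongr
      _ ≤ 2 / q.re * Real.exp ((1 - q.re) * v) := by
          rw [← Real.exp_add]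
          gcongr
          exact le_of_eq (by ring)
      _ ≤ _ := by
          rw [abs_of_nonpos hv]
          gcongr
          have := min_le_right (q.re / 2) (1 - q.re)
          nlinarith

theorem continuous_log_one_add_exp_ofReal :
    Continuous fun v : ℝ => Complex.log (1 + Complex.exp v) := by
  refine continuous_iff_continuousAt.2 fun v => ?_
  exact ContinuousAt.comp (f := fun v : ℝ => (v : ℂ))
    (hasDerivAt_log_one_add_exp (z := v) (by simpa using Real.pi_pos)).continuousAt (by fun_prop)

theorem continuous_logistic_ofReal : Continuous fun v : ℝ => logistic v := by
  simp_rw [logistic_ofReal]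
  exact Complex.continuous_ofReal.comp continuous_sigmoid

theorem integrable_log_one_add_exp_mul_exp {q : ℂ} (h0 : 0 < q.re) (h1 : q.re < 1) :
    Integrable fun v : ℝ => Complex.log (1 + Complex.exp v) * Complex.exp (-(q * v)) := by
  have hcont := continuous_log_one_add_exp_ofReal
  refine ((integrable_exp_neg_mul_abs (k := min (q.re / 2) (1 - q.re))
    (lt_min (by linarith) (by linarith))).const_mul (2 / q.re)).mono'
    (by fun_prop : Continuous _).aestronglyMeasurable
    (Eventually.of_forall (norm_log_one_add_exp_mul_exp_le h0 h1))

/-- The Fourier integral behind `1 / (x sinh (x b))`; integration by parts reduces it to that of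
the logistic function. -/
theorem integral_log_one_add_exp_mul_exp {q : ℂ} (h0 : 0 < q.re) (h1 : q.re < 1) :
    ∫ v : ℝ, Complex.log (1 + Complex.exp v) * Complex.exp (-(q * v)) =
      Real.pi / (q * Complex.sin (Real.pi * q)) := by
  have hq : q ≠ 0 := by rintro rfl; simp at h0
  have hcont := continuous_logistic_ofReal
  have i1 := integrable_log_one_add_exp_mul_exp h0 h1
  have i2 : Integrable fun v : ℝ => logistic v * Complex.exp (-(q * v)) :=
    (integrable_exp_neg_mul_abs (k := min (q.re / 2) (1 - q.re))
      (lt_min (by linarith) (by linarith))).mono'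
      (by fun_prop : Continuous _).aestronglyMeasurable
      (Eventually.of_forall (norm_logistic_mul_exp_le h0))
  have hu : ∀ v : ℝ, HasDerivAt (fun v : ℝ => Complex.log (1 + Complex.exp v)) (logistic v) v :=
    fun v => by
      have := HasDerivAt.comp (h₂ := fun z => Complex.log (1 + Complex.exp z)) v
        (hasDerivAt_log_one_add_exp (z := v) (by simpa using Real.pi_pos))
        (hasDerivAt_id v).ofReal_comp
      exact this.congr_deriv (by simp)
  have hv : ∀ v : ℝ, HasDerivAt (fun v : ℝ => -q⁻¹ * Complex.exp (-(q * v)))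
      (Complex.exp (-(q * v))) v := fun v => by
    have h2 : HasDerivAt (fun v : ℝ => -(q * (v : ℂ))) (-q) v := by
      simpa using ((hasDerivAt_id v).ofReal_comp.const_mul q).fun_neg
    refine (h2.cexp.const_mul (-q⁻¹)).congr_deriv ?_
    field_simp
  have := integral_mul_deriv_eq_deriv_mul_of_integrable (fun v _ => hu v) (fun v _ => hv v) i1
    ((i2.const_mul (-q⁻¹)).congr (Eventually.of_forall fun v => by
      simp only [Pi.mul_apply]; ring))
    ((i1.const_mul (-q⁻¹)).congr (Eventually.of_forall fun v => by
      simp only [Pi.mul_apply]; ring))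
  rw [this]
  have h3 : ∀ v : ℝ, logistic v * (-q⁻¹ * Complex.exp (-(q * v))) =
      -q⁻¹ * (logistic v * Complex.exp (-(q * v))) := fun v => by ring
  simp_rw [h3]
  rw [integral_const_mul, integral_logistic_mul_exp h0 h1, div_mul_eq_div_div_swap]
  field_simp

/-- Identity theorem for functions that agree on a real interval around `z₀`. -/
theorem eqOn_of_eventually_eq_add_ofReal {f g : ℂ → ℂ} {U : Set ℂ} {z₀ : ℂ} (hU : IsOpen U)
    (hUc : IsPreconnected U) (hf : DifferentiableOn ℂ f U) (hg : DifferentiableOn ℂ g U)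
    (h₀ : z₀ ∈ U) (h : ∀ᶠ r : ℝ in 𝓝 0, f (z₀ + r) = g (z₀ + r)) : EqOn f g U := by
  refine (hf.analyticOnNhd hU).eqOn_of_preconnected_of_frequently_eq (hg.analyticOnNhd hU) hUc h₀ ?_
  have h1 : Tendsto (fun r : ℝ => z₀ + r) (𝓝[≠] 0) (𝓝[≠] z₀) := by
    refine tendsto_nhdsWithin_iff.2 ⟨?_, ?_⟩
    · have : ContinuousAt (fun r : ℝ => z₀ + (r : ℂ)) 0 := by fun_prop
      exact (by simpa [ContinuousAt] using this : Tendsto _ _ _).mono_left nhdsWithin_le_nhds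
    · filter_upwards [self_mem_nhdsWithin] with r hr
      simpa using hr
  exact h1.frequently (h.filter_mono nhdsWithin_le_nhds).frequently

theorem exp_div_cosh (x : ℂ) : Complex.exp x / Complex.cosh x = 2 * logistic (2 * x) := by
  have h : Complex.cosh x = Complex.exp x * (1 + Complex.exp (-(2 * x))) / 2 := by
    rw [Complex.cosh, mul_add, ← Complex.exp_add]
    ring_nf
  rw [h, logistic]
  have := Complex.exp_ne_zero x
  field_simp

/-- The Fourier transform of `1 / sinh` along the line `Im y = π / 2`, where `sinh` is
`i cosh`. -/
theorem integral_exp_div_cosh {s : ℂ} (hs : |s.im| < Real.pi) :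
    ∫ t : ℝ, Complex.exp (-(Complex.I * (t + Real.pi / 2 * Complex.I) * s / Real.pi)) /
      Complex.sinh (t + Real.pi / 2 * Complex.I) = -2 * Real.pi * Complex.I * logistic s := by
  have hpi : (Real.pi : ℂ) ≠ 0 := by exact_mod_cast Real.pi_ne_zero
  set q : ℂ := 1 / 2 + Complex.I * s / (2 * Real.pi)
  have hq : q.re = 1 / 2 - s.im / (2 * Real.pi) := by
    have : Complex.I * s / (2 * Real.pi) = ((1 / (2 * Real.pi) : ℝ) : ℂ) * (Complex.I * s) := by
      push_cast; ring
    simp only [q, this, Complex.add_re, Complex.re_ofReal_mul]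
    simp
    ring
  have hqs : |s.im / (2 * Real.pi)| < 1 / 2 := by
    rw [abs_div, abs_of_pos (by positivity : 0 < 2 * Real.pi), div_lt_iff₀ (by positivity)]
    linarith
  have hg : ∀ t : ℝ, Complex.exp (-(Complex.I * (t + Real.pi / 2 * Complex.I) * s / Real.pi)) /
      Complex.sinh (t + Real.pi / 2 * Complex.I) = -2 * Complex.I * Complex.exp (s / 2) *
        (logistic ((2 * t : ℝ) : ℂ) * Complex.exp (-(q * ((2 * t : ℝ) : ℂ)))) := by
    intro t
    have h1 : Complex.sinh (t + Real.pi / 2 * Complex.I) = Complex.I * Complex.cosh t := by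
      rw [Complex.sinh_add, Complex.cosh_mul_I, Complex.sinh_mul_I, Complex.cos_pi_div_two,
        Complex.sin_pi_div_two]
      ring
    have h2 : Complex.exp (-(Complex.I * (t + Real.pi / 2 * Complex.I) * s / Real.pi)) =
        Complex.exp (s / 2) * Complex.exp (-(q * ((2 * t : ℝ) : ℂ))) * Complex.exp t := by
      rw [← Complex.exp_add, ← Complex.exp_add]
      congr 1
      simp only [q]
      push_cast
      field_simp
      ring_nf
      rw [Complex.I_sq]
      ring
    have h3 := exp_div_cosh (t : ℂ)
    push_cast at h2 ⊢
    calc _ = Complex.I⁻¹ * Complex.exp (s / 2) * Complex.exp (-(q * (2 * t))) *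
          (Complex.exp t / Complex.cosh t) := by rw [h1, h2]; field_simp
      _ = _ := by rw [h3, Complex.inv_I]; ring
  simp_rw [hg]
  rw [integral_const_mul, Measure.integral_comp_mul_left
    (fun v : ℝ => logistic (v : ℂ) * Complex.exp (-(q * v))), integral_logistic_mul_exp
      (by rw [hq]; linarith [(abs_lt.1 hqs).2]) (by rw [hq]; linarith [(abs_lt.1 hqs).1])]
  have h4 : Complex.sin (Real.pi * q) = Complex.cosh (s / 2) := by
    rw [show Real.pi * q = s / 2 * Complex.I + Real.pi / 2 by simp only [q]; field_simp; ring,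
      Complex.sin_add_pi_div_two, Complex.cos_mul_I]
  have h5 := exp_div_cosh (s / 2)
  rw [mul_div_cancel₀ s two_ne_zero] at h5
  rw [h4, Complex.real_smul, abs_of_pos (by norm_num)]
  push_cast
  linear_combination -Complex.I * Real.pi * h5

/-- The zeros of `sinh (y ω)` are the points `y = π i n / ω`. -/
theorem sinh_mul_ne_zero {ω y : ℂ} (hω : 0 < ω.re) (h0 : 0 < y.im)
    (h1 : y.im < Real.pi * (ω⁻¹).re) : Complex.sinh (y * ω) ≠ 0 := by
  have hω0 : ω ≠ 0 := by rintro rfl; simp at hω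
  intro h
  obtain ⟨n, hn⟩ := Complex.sin_eq_zero_iff.1 (show Complex.sin (-(y * ω * Complex.I)) = 0 by
    rw [Complex.sin_neg, Complex.sin_mul_I, h]; simp)
  have hy : y = ((n * Real.pi : ℝ) : ℂ) * (ω⁻¹ * Complex.I) := by
    push_cast
    rw [← hn]
    field_simp
    rw [Complex.I_sq]
    ring
  have him : y.im = n * (Real.pi * (ω⁻¹).re) := by
    rw [hy, Complex.im_ofReal_mul]
    simp [mul_assoc]
  have hpos : 0 < Real.pi * (ω⁻¹).re := h0.trans h1
  rw [him] at h0 h1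
  have h2 : (0 : ℝ) < n := pos_of_mul_pos_left h0 hpos.le
  have h3 : (n : ℝ) < 1 := by nlinarith
  have h4 : (0 : ℤ) < n := by exact_mod_cast h2
  have h5 : n < (1 : ℤ) := by exact_mod_cast h3
  omega

theorem sinh_ne_zero_of_im {y : ℂ} (h0 : 0 < y.im) (h1 : y.im < Real.pi) :
    Complex.sinh y ≠ 0 := by
  simpa using sinh_mul_ne_zero (ω := 1) (by simp) h0 (by simpa using h1)

/-- On a line in `0 < Im y < π`, the function `exp (-i y s / π) / sinh y` decays exponentially,
locally uniformly in the line. -/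
theorem eventually_norm_exp_div_sinh_le {s p₀ : ℂ} (hs : |s.im| < Real.pi) (h0 : 0 < p₀.im)
    (h1 : p₀.im < Real.pi) :
    ∃ k > 0, ∃ C, ∀ᶠ p in 𝓝 p₀, ∀ t : ℝ,
      ‖Complex.exp (-(Complex.I * (t + p) * s / Real.pi)) / Complex.sinh (t + p)‖ ≤
        C * Real.exp (-(k * |t|)) := by
  have hpi := Real.pi_pos
  obtain ⟨k, hk1, hk2⟩ := exists_between ((div_lt_one hpi).2 hs)
  obtain ⟨m, hm, hm'⟩ := eventually_exp_le_norm_sinh (ω₀ := 1) (d₀ := p₀) (k := k) (by simp)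
    (by simpa using hk2) (fun t => sinh_ne_zero_of_im (by simpa using h0) (by simpa using h1))
  set B : ℂ → ℝ := fun p => Real.exp ((p.re * s.im + p.im * s.re) / Real.pi)
  have hB : ∀ᶠ p in 𝓝 p₀, B p < B p₀ + 1 :=
    (by fun_prop : Continuous B).continuousAt.eventually (gt_mem_nhds (by linarith))
  have hpair : Tendsto (fun p : ℂ => ((1 : ℂ), p)) (𝓝 p₀) (𝓝 (1, p₀)) :=
    (by fun_prop : Continuous fun p : ℂ => ((1 : ℂ), p)).continuousAt
  refine ⟨k - |s.im| / Real.pi, by linarith, (B p₀ + 1) / m, ?_⟩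
  filter_upwards [hpair.eventually hm', hB] with p hp hpB t
  have hden := hp t
  simp only [one_mul] at hden
  have hnum : ‖Complex.exp (-(Complex.I * (t + p) * s / Real.pi))‖ ≤
      (B p₀ + 1) * Real.exp (|s.im| / Real.pi * |t|) := by
    have e : (-(Complex.I * (t + p) * s / Real.pi)).re =
        (p.re * s.im + p.im * s.re) / Real.pi + t * s.im / Real.pi := by
      rw [show -(Complex.I * (t + p) * s / Real.pi) =
        ((1 / Real.pi : ℝ) : ℂ) * (-(Complex.I * (t + p) * s)) by push_cast; ring,
        Complex.re_ofReal_mul]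
      simp
      ring
    rw [Complex.norm_exp, e, Real.exp_add]
    have h3 : t * s.im / Real.pi ≤ |s.im| / Real.pi * |t| := by
      rw [div_mul_eq_mul_div, ← abs_mul, mul_comm]
      gcongr
      exact le_abs_self _
    gcongr
  rw [norm_div]
  calc _ ≤ (B p₀ + 1) * Real.exp (|s.im| / Real.pi * |t|) / (m * Real.exp (k * |t|)) := by gcongr
    _ = (B p₀ + 1) / m * (Real.exp (|s.im| / Real.pi * |t|) * (Real.exp (k * |t|))⁻¹) := by
        rw [mul_div_mul_comm, div_eq_mul_inv (Real.exp _)]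
    _ = _ := by
        rw [← Real.exp_neg, ← Real.exp_add]
        ring_nf

theorem measurable_exp_div_sinh (s p : ℂ) : Measurable fun t : ℝ =>
    Complex.exp (-(Complex.I * (t + p) * s / Real.pi)) / Complex.sinh (t + p) := by
  fun_prop

theorem integrable_exp_div_sinh {s : ℂ} (hs : |s.im| < Real.pi) {ε : ℝ} (h0 : 0 < ε)
    (h1 : ε < Real.pi) :
    Integrable fun t : ℝ => Complex.exp (-(Complex.I * (t + ε * Complex.I) * s / Real.pi)) /
      Complex.sinh (t + ε * Complex.I) := by
  obtain ⟨k, hk, C, h⟩ := eventually_norm_exp_div_sinh_le (s := s) (p₀ := ε * Complex.I) hs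
    (by simpa using h0) (by simpa using h1)
  exact ((integrable_exp_neg_mul_abs hk).const_mul C).mono'
    (measurable_exp_div_sinh s _).aestronglyMeasurable (Eventually.of_forall h.self_of_nhds)

/-- The Fourier transform of `1 / sinh` along any line in the strip `0 < Im y < π`. As a function
of the line, the integral is holomorphic and invariant under real translations. -/
theorem integral_exp_div_sinh {s : ℂ} (hs : |s.im| < Real.pi) {ε : ℝ} (h0 : 0 < ε)
    (h1 : ε < Real.pi) :
    ∫ t : ℝ, Complex.exp (-(Complex.I * (t + ε * Complex.I) * s / Real.pi)) /
      Complex.sinh (t + ε * Complex.I) = -2 * Real.pi * Complex.I * logistic s := by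
  set f : ℂ → ℝ → ℂ := fun p t =>
    Complex.exp (-(Complex.I * (t + p) * s / Real.pi)) / Complex.sinh (t + p) with hf
  set U : Set ℂ := Complex.imLm ⁻¹' Ioo 0 Real.pi with hU
  have hmemU : ∀ p : ℂ, p ∈ U ↔ 0 < p.im ∧ p.im < Real.pi := fun p => by simp [hU]
  have hUo : IsOpen U := isOpen_Ioo.preimage Complex.continuous_im
  have hUc : IsPreconnected U := ((convex_Ioo _ _).linear_preimage _).isPreconnected
  have hd : DifferentiableOn ℂ (fun p => ∫ t : ℝ, f p t) U := by
    intro p₀ hp₀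
    obtain ⟨k, hk, C, h⟩ := eventually_norm_exp_div_sinh_le (s := s) (p₀ := p₀) hs
      ((hmemU _).1 hp₀).1 ((hmemU _).1 hp₀).2
    refine (differentiableAt_integral_of_dominated (inter_mem h (hUo.mem_nhds hp₀))
      (fun p _ => (measurable_exp_div_sinh s p).aestronglyMeasurable)
      (Eventually.of_forall fun t p hp => ?_) (Eventually.of_forall fun t p hp => hp.1 t)
      ((integrable_exp_neg_mul_abs hk).const_mul C)).differentiableWithinAt
    have hne : Complex.sinh (t + p) ≠ 0 := by
      have := (hmemU _).1 hp.2
      exact sinh_ne_zero_of_im (by simpa using this.1) (by simpa using this.2)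
    have : DifferentiableAt ℂ (fun p => f p t) p := by
      simp only [hf]
      fun_prop (disch := assumption)
    exact this.differentiableWithinAt
  have hpi := Real.pi_pos
  have hE := eqOn_of_eventually_eq_add_ofReal (g := fun _ => -2 * Real.pi * Complex.I * logistic s)
    (z₀ := Real.pi / 2 * Complex.I) hUo hUc hd (differentiableOn_const _)
    ((hmemU _).2 (by
      have : (Real.pi / 2 * Complex.I : ℂ).im = Real.pi / 2 := by simp
      rw [this]
      constructor <;> linarith)) (Eventually.of_forall fun r => ?_)
  · exact hE ((hmemU (ε * Complex.I)).2 (by simpa using ⟨h0, h1⟩))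
  · rw [← integral_exp_div_cosh hs]
    refine Eq.trans ?_ (integral_add_right_eq_self
      (fun t : ℝ => f (Real.pi / 2 * Complex.I) t) r)
    congr 1 with t
    simp only [hf]
    push_cast
    ring_nf

/-! ### The closed form for real `b` -/

theorem log_one_add_exp_eq_add (v : ℝ) :
    Complex.log (1 + Complex.exp v) = v + Complex.log (1 + Complex.exp ((-v : ℝ) : ℂ)) := by
  rw [log_one_add_exp_ofReal, log_one_add_exp_ofReal]
  have : Real.log (1 + Real.exp v) = v + Real.log (1 + Real.exp (-v)) := by
    rw [show 1 + Real.exp v = Real.exp v * (1 + Real.exp (-v)) by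
      rw [mul_add, ← Real.exp_add]; simp [add_comm], Real.log_mul (by positivity) (by positivity),
      Real.log_exp]
  exact_mod_cast this

theorem hasSum_log_one_add_exp_neg {v : ℝ} (hv : 0 < v) :
    HasSum (fun k : ℕ => (-1 : ℂ) ^ k / ((k : ℂ) + 1) * Complex.exp (-(((k : ℂ) + 1) * v)))
      (Complex.log (1 + Complex.exp ((-v : ℝ) : ℂ))) := by
  have h := (Complex.hasSum_taylorSeries_neg_log' (z := -Complex.exp ((-v : ℝ) : ℂ)) (by
    rw [norm_neg, Complex.norm_exp]; simpa using hv)).neg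
  rw [neg_neg, sub_neg_eq_add] at h
  refine h.congr_fun fun k => ?_
  rw [neg_pow (Complex.exp _), ← Complex.exp_nat_mul]
  push_cast
  rw [show -(((k : ℂ) + 1) * v) = ((k : ℂ) + 1) * -v by ring]
  ring

theorem norm_exp_neg_succ_mul_mul_le {w : ℂ} {C v : ℝ} (hw : ‖w‖ ≤ C) (k : ℕ) :
    ‖(-1 : ℂ) ^ k / ((k : ℂ) + 1) * (Complex.exp (-(((k : ℂ) + 1) * v)) * w)‖ ≤
      1 / ((k : ℝ) + 1) * (C * Real.exp (-((k : ℝ) + 1) * v)) := by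
  refine norm_mul_le_of_le ?_ ?_
  · rw [norm_div, norm_natCast_add_one]
    simp
  · simpa using norm_exp_neg_mul_mul_le (κ := (k : ℂ) + 1) (v := v) hw

/-- Termwise integration of the logarithmic series. -/
theorem hasSum_integral_log_one_add_exp_neg {g : ℝ → ℂ} {C : ℝ} (hg : Continuous g)
    (hC : ∀ v, ‖g v‖ ≤ C) :
    HasSum (fun k : ℕ => (-1 : ℂ) ^ k / ((k : ℂ) + 1) *
        ∫ v in Ioi (0 : ℝ), Complex.exp (-(((k : ℂ) + 1) * v)) * g v)
      (∫ v in Ioi (0 : ℝ), Complex.log (1 + Complex.exp ((-v : ℝ) : ℂ)) * g v) := by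
  have hre : ∀ k : ℕ, 0 < ((k : ℂ) + 1).re := fun k => by simp; positivity
  have hi : ∀ k : ℕ, IntegrableOn (fun v : ℝ =>
      (-1 : ℂ) ^ k / ((k : ℂ) + 1) * (Complex.exp (-(((k : ℂ) + 1) * v)) * g v)) (Ioi 0) :=
    fun k => (integrableOn_laplace (hre k) hg hC).const_mul _
  have hs : Summable fun k : ℕ => ∫ v in Ioi (0 : ℝ),
      ‖(-1 : ℂ) ^ k / ((k : ℂ) + 1) * (Complex.exp (-(((k : ℂ) + 1) * v)) * g v)‖ := by
    refine Summable.of_nonneg_of_le (fun k => integral_nonneg fun v => norm_nonneg _) (fun k => ?_)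
      (hasSum_inv_succ_sq.summable.mul_left C)
    have hk : (0 : ℝ) < (k : ℝ) + 1 := by positivity
    calc _ ≤ ∫ v in Ioi (0 : ℝ), 1 / ((k : ℝ) + 1) * (C * Real.exp (-((k : ℝ) + 1) * v)) :=
          integral_mono (hi k).norm ((integrableOn_exp_neg_mul_const hk C).const_mul _)
            fun v => norm_exp_neg_succ_mul_mul_le (hC v) k
      _ = C * (1 / ((k : ℝ) + 1) ^ 2) := by
          rw [integral_const_mul, integral_const_mul, integral_exp_mul_Ioi (by linarith), mul_zero,
            Real.exp_zero, neg_div_neg_eq]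
          field_simp
  have := hasSum_integral_of_summable_integral_norm hi hs
  simp only [integral_const_mul] at this
  convert! this using 1
  refine setIntegral_congr_fun measurableSet_Ioi fun v hv => ?_
  rw [← (hasSum_log_one_add_exp_neg hv).tsum_eq, ← tsum_mul_right]
  exact tsum_congr fun k => by ring

theorem integrableOn_log_one_add_exp_neg {g : ℝ → ℂ} {C : ℝ} (hg : Continuous g)
    (hC : ∀ v, ‖g v‖ ≤ C) :
    IntegrableOn (fun v : ℝ => Complex.log (1 + Complex.exp ((-v : ℝ) : ℂ)) * g v) (Ioi 0) := by
  have hcont := continuous_log_one_add_exp_ofReal.comp continuous_neg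
  refine (integrableOn_exp_neg_mul_const one_pos C).mono' (hcont.mul hg).aestronglyMeasurable
    (Eventually.of_forall fun v => ?_)
  rw [norm_mul, log_one_add_exp_ofReal, Complex.norm_real,
    Real.norm_of_nonneg (Real.log_nonneg (by linarith [Real.exp_pos (-v)])), mul_comm]
  have h2 : Real.log (1 + Real.exp (-v)) ≤ Real.exp (-1 * v) := by
    have := Real.log_le_sub_one_of_pos (x := 1 + Real.exp (-v)) (by positivity)
    rw [neg_one_mul]
    linarith
  have : 0 ≤ C := (norm_nonneg _).trans (hC v)
  gcongr
  · exact Real.log_nonneg (by linarith [Real.exp_pos (-v)])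
  · exact hC v

/-- The convolution of `log (1 + exp v)` with the logistic function in closed form. -/
theorem integral_log_one_add_exp_mul_logistic {z : ℂ} (hz : |z.im| < Real.pi) {τ : ℝ} (hτ : 0 < τ) :
    Complex.I * τ / (2 * Real.pi) *
      ∫ v : ℝ, Complex.log (1 + Complex.exp v) * logistic (z - τ * v) =
      laplaceLogDilog (τ : ℂ)⁻¹ z := by
  have hτ0 : (τ : ℂ) ≠ 0 := by exact_mod_cast hτ.ne'
  have hpi : (Real.pi : ℂ) ≠ 0 := by exact_mod_cast Real.pi_ne_zero
  obtain ⟨C, hC⟩ := exists_norm_iteratedDeriv_logistic_line_le hz 0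
  have hcont : ∀ a : ℝ, Continuous fun v : ℝ => logistic (z + a * v) := fun a =>
    continuous_logistic_line hz (by simp)
  have hcp := hcont τ
  have hcm : Continuous fun v : ℝ => logistic (z - τ * v) := by
    have := hcont (-τ)
    push_cast at this
    simpa [sub_eq_add_neg] using this
  have hbp : ∀ v : ℝ, ‖logistic (z + τ * v)‖ ≤ C := fun v => by
    simpa using hC (z + τ * v) (by simp)
  have hbm : ∀ v : ℝ, ‖logistic (z - τ * v)‖ ≤ C := fun v => by
    simpa using hC (z - τ * v) (by simp)
  -- the part that carries the dilogarithm
  have hD : IntegrableOn (fun v : ℝ => (v : ℂ) * logistic (z - τ * v)) (Ioi 0) ∧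
      ∫ v in Ioi (0 : ℝ), (v : ℂ) * logistic (z - τ * v) =
        -(τ : ℂ)⁻¹ ^ 2 * dilog (-Complex.exp z) := by
    have h1 : ∀ v : ℝ, (v : ℂ) * logistic (z - τ * v) =
        (τ : ℂ)⁻¹ * (((τ * v : ℝ) : ℂ) * logistic (z - ((τ * v : ℝ) : ℂ))) := fun v => by
      push_cast
      field_simp
    simp_rw [h1]
    constructor
    · refine Integrable.const_mul ?_ _
      have := (integrableOn_Ioi_comp_mul_left_iff
        (fun u : ℝ => (u : ℂ) * logistic (z - u)) 0 hτ).2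
        (by simpa using integrableOn_mul_logistic_sub hz)
      exact this
    · rw [integral_const_mul,
        integral_comp_mul_left_Ioi (fun u : ℝ => (u : ℂ) * logistic (z - u)) 0 hτ, mul_zero,
        integral_mul_logistic_sub hz, Complex.real_smul]
      push_cast
      ring
  have iP := integrableOn_log_one_add_exp_neg hcp hbp
  have iM := integrableOn_log_one_add_exp_neg hcm hbm
  have hsplitM : ∀ v : ℝ, Complex.log (1 + Complex.exp v) * logistic (z - τ * v) =
      v * logistic (z - τ * v) +
        Complex.log (1 + Complex.exp ((-v : ℝ) : ℂ)) * logistic (z - τ * v) := fun v => by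
    rw [log_one_add_exp_eq_add]; ring
  have i1 : IntegrableOn (fun v : ℝ => Complex.log (1 + Complex.exp v) * logistic (z - τ * v))
      (Ioi 0) := by
    simp_rw [hsplitM]
    exact hD.1.add iM
  have i2 : IntegrableOn (fun v : ℝ => Complex.log (1 + Complex.exp v) * logistic (z - τ * v))
      (Iic 0) := by
    rw [← neg_zero] at iP
    rw [integrableOn_Iic_iff_integrableOn_Iio]
    simpa [sub_eq_add_neg] using iP.comp_neg_Iio
  have hneg : ∫ v in Iic (0 : ℝ), Complex.log (1 + Complex.exp v) * logistic (z - τ * v) =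
      ∫ v in Ioi (0 : ℝ), Complex.log (1 + Complex.exp ((-v : ℝ) : ℂ)) * logistic (z + τ * v) := by
    have := integral_comp_neg_Ioi (0 : ℝ)
      (fun v : ℝ => Complex.log (1 + Complex.exp v) * logistic (z - τ * v))
    rw [neg_zero] at this
    rw [← this]
    simp
  have hser := hasSum_integral_log_one_add_exp_neg
    (by fun_prop : Continuous fun v : ℝ => logistic (z + τ * v) + logistic (z - τ * v))
    (fun v => norm_add_le_of_le (hbp v) (hbm v))
  have hlap : ∀ k : ℕ, (-1 : ℂ) ^ k / ((k : ℂ) + 1) ^ 2 *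
      logisticLaplace (τ : ℂ)⁻¹ z (1 / ((k : ℝ) + 1)) 0 =
      τ * ((-1 : ℂ) ^ k / ((k : ℂ) + 1) * ∫ v in Ioi (0 : ℝ), Complex.exp (-(((k : ℂ) + 1) * v)) *
        (logistic (z + τ * v) + logistic (z - τ * v))) := by
    intro k
    have hk : ((k : ℂ) + 1) ≠ 0 := by exact_mod_cast Nat.succ_ne_zero k
    have hkr : 0 < ((k : ℝ) + 1) * τ := by positivity
    have h1 := integral_comp_mul_left_Ioi (fun w : ℝ => Complex.exp (-((τ : ℂ)⁻¹ * w)) *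
      (logistic (z + (1 / ((k : ℝ) + 1) : ℝ) * w) + logistic (z - (1 / ((k : ℝ) + 1) : ℝ) * w)))
      0 hkr
    rw [mul_zero, Complex.real_smul] at h1
    have h2 : ∫ v in Ioi (0 : ℝ), Complex.exp (-(((k : ℂ) + 1) * v)) *
        (logistic (z + τ * v) + logistic (z - τ * v)) =
        ((((k : ℝ) + 1) * τ)⁻¹ : ℝ) * logisticLaplace (τ : ℂ)⁻¹ z (1 / ((k : ℝ) + 1)) 0 := by
      simp only [logisticLaplace, iteratedDeriv_zero]
      rw [← h1]
      congr 1 with v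
      have e1 : (τ : ℂ)⁻¹ * ((((k : ℝ) + 1) * τ * v : ℝ) : ℂ) = ((k : ℂ) + 1) * v := by
        push_cast; field_simp
      have e2 : ((1 / ((k : ℝ) + 1) : ℝ) : ℂ) * ((((k : ℝ) + 1) * τ * v : ℝ) : ℂ) = τ * v := by
        push_cast; field_simp
      rw [e1, e2]
    rw [h2]
    push_cast
    field_simp
  rw [laplaceLogDilog, tsum_congr hlap, tsum_mul_left, hser.tsum_eq,
    ← setIntegral_univ, ← Iic_union_Ioi (a := (0 : ℝ)),
    setIntegral_union (Iic_disjoint_Ioi le_rfl) measurableSet_Ioi i2 i1, hneg]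
  simp_rw [hsplitM]
  rw [integral_add hD.1 iM, hD.2]
  simp_rw [mul_add]
  rw [integral_add iP iM]
  field_simp
  rw [Complex.I_sq]
  ring

/-- For real `b` the contour integral is computed by writing `1 / (x sinh (x b))` as a Fourier
integral, exchanging the integrals, and evaluating the Fourier transform of `1 / sinh (x / b)`. -/
theorem integral_faddeevIntegrand_ofReal {z : ℂ} (hz : |z.im| < Real.pi) {b ε : ℝ} (hb : 0 < b)
    (hε : 0 < ε) (hεb : ε * b < Real.pi) (hεb' : ε / b < Real.pi) :
    ∫ t : ℝ, faddeevIntegrand b (z / (2 * Real.pi * b)) ((t : ℂ) + ε * Complex.I) =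
      laplaceLogDilog ((b : ℂ) ^ 2)⁻¹ z := by
  have hpi := Real.pi_pos
  have hpi0 : (Real.pi : ℂ) ≠ 0 := by exact_mod_cast hpi.ne'
  have hb0 : (b : ℂ) ≠ 0 := by exact_mod_cast hb.ne'
  set q : ℝ → ℂ := fun t => -(Complex.I * (t + ε * Complex.I) * b / Real.pi) with hq
  have hqre : ∀ t, (q t).re = ε * b / Real.pi := fun t => by
    have : q t = ((b / Real.pi : ℝ) : ℂ) * (-(Complex.I * (t + ε * Complex.I))) := by
      simp only [hq]; push_cast; ring
    rw [this, Complex.re_ofReal_mul]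
    simp
    ring
  have hq0 : 0 < ε * b / Real.pi := by positivity
  have hq1 : ε * b / Real.pi < 1 := (div_lt_one hpi).2 hεb
  -- the transform of `1 / sinh (x / b)`
  set g : ℂ → ℝ → ℂ := fun s t =>
    Complex.exp (-(Complex.I * ((t : ℂ) + ε * Complex.I) * s / (b * Real.pi))) /
      Complex.sinh ((t + ε * Complex.I) / b) with hg
  have hgs : ∀ s t, g s t = Complex.exp (-(Complex.I * (((b⁻¹ * t : ℝ) : ℂ) +
      ((ε / b : ℝ) : ℂ) * Complex.I) * s / Real.pi)) /
      Complex.sinh (((b⁻¹ * t : ℝ) : ℂ) + ((ε / b : ℝ) : ℂ) * Complex.I) := fun s t => by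
    simp only [hg]
    have : (((b⁻¹ * t : ℝ) : ℂ) + ((ε / b : ℝ) : ℂ) * Complex.I) = (t + ε * Complex.I) / b := by
      push_cast; field_simp
    rw [this]
    congr 2
    field_simp
  have hgi : ∀ s : ℂ, |s.im| < Real.pi → Integrable (g s) := fun s hs => by
    have := (integrable_exp_div_sinh hs (div_pos hε hb) hεb').comp_mul_left' (inv_ne_zero hb.ne')
    exact this.congr (Eventually.of_forall fun t => (hgs s t).symm)
  have hgint : ∀ s : ℂ, |s.im| < Real.pi →
      ∫ t : ℝ, g s t = b * (-2 * Real.pi * Complex.I * logistic s) := fun s hs => by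
    simp_rw [hgs]
    rw [Measure.integral_comp_mul_left (fun t : ℝ => Complex.exp (-(Complex.I * ((t : ℂ) +
      ((ε / b : ℝ) : ℂ) * Complex.I) * s / Real.pi)) /
      Complex.sinh ((t : ℂ) + ((ε / b : ℝ) : ℂ) * Complex.I)),
      integral_exp_div_sinh hs (div_pos hε hb) hεb', inv_inv, abs_of_pos hb, Complex.real_smul]
  -- the integrand as a Fourier integral
  have hF : ∀ t : ℝ, faddeevIntegrand b (z / (2 * Real.pi * b)) ((t : ℂ) + ε * Complex.I) =
      -(b / (4 * Real.pi ^ 2)) * ∫ v : ℝ,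
        Complex.log (1 + Complex.exp v) * Complex.exp (-(q t * v)) * g z t := by
    intro t
    set x : ℂ := (t : ℂ) + ε * Complex.I with hx
    have hxim : x.im = ε := by simp [hx]
    have hx0 : x ≠ 0 := fun h => by simp [h] at hxim; linarith
    have hsin : Complex.sin (Real.pi * q t) = -(Complex.sinh (x * b) * Complex.I) := by
      rw [show Real.pi * q t = -(x * b * Complex.I) by simp only [hq]; field_simp; ring,
        Complex.sin_neg, Complex.sin_mul_I]
    have hs1 : Complex.sinh (x * b) ≠ 0 := by
      refine sinh_ne_zero_of_im ?_ ?_ <;> rw [Complex.im_mul_ofReal, hxim]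
      · positivity
      · exact hεb
    have hs2 : Complex.sinh (x / b) ≠ 0 := by
      refine sinh_ne_zero_of_im ?_ ?_ <;> rw [Complex.div_ofReal_im, hxim]
      · positivity
      · exact hεb'
    rw [integral_mul_const, integral_log_one_add_exp_mul_exp (by rw [hqre]; exact hq0)
      (by rw [hqre]; exact hq1), hsin]
    have hexp : -2 * Complex.I * x * (z / (2 * Real.pi * b)) =
        -(Complex.I * x * z / (b * Real.pi)) := by
      field_simp
    simp only [hg, hq, ← hx, faddeevIntegrand, hexp]
    field_simp
    rw [Complex.I_sq]
  -- the exchanged integrand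
  have hsw : ∀ t v : ℝ, Complex.log (1 + Complex.exp v) * Complex.exp (-(q t * v)) * g z t =
      Complex.log (1 + Complex.exp v) * g (z - ((b ^ 2 : ℝ) : ℂ) * v) t := by
    intro t v
    simp only [hg]
    rw [mul_assoc, ← mul_div_assoc, ← Complex.exp_add]
    congr 3
    simp only [hq]
    push_cast
    field_simp
    ring
  have hL := continuous_log_one_add_exp_ofReal
  have hprod : Integrable (Function.uncurry fun t v : ℝ =>
      Complex.log (1 + Complex.exp v) * Complex.exp (-(q t * v)) * g z t)
      (volume.prod volume) := by
    have h1 := integrable_log_one_add_exp_mul_exp (q := ((ε * b / Real.pi : ℝ) : ℂ))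
      (by simpa using hq0) (by simpa using hq1)
    refine ((hgi z hz).mul_prod h1).mono ?_ (Eventually.of_forall fun p => le_of_eq ?_)
    · refine Measurable.aestronglyMeasurable ?_
      simp only [hg, hq, Function.uncurry_def]
      fun_prop
    · simp only [Function.uncurry_def, norm_mul, Complex.norm_exp]
      have : (-(q p.1 * p.2)).re = (-(((ε * b / Real.pi : ℝ) : ℂ) * p.2)).re := by
        simp only [Complex.neg_re, Complex.re_mul_ofReal, hqre, Complex.ofReal_re]
      rw [this]
      ring
  simp_rw [hF]
  rw [integral_const_mul, integral_integral_swap hprod]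
  have him : ∀ v : ℝ, |(z - ((b ^ 2 : ℝ) : ℂ) * v).im| < Real.pi := fun v => by
    have : (z - ((b ^ 2 : ℝ) : ℂ) * v).im = z.im := by
      rw [Complex.sub_im, Complex.im_mul_ofReal, Complex.ofReal_im]; simp
    rwa [this]
  simp_rw [hsw, integral_const_mul, hgint _ (him _)]
  rw [show ((b : ℂ) ^ 2)⁻¹ = (((b ^ 2 : ℝ) : ℂ))⁻¹ by push_cast; rfl,
    ← integral_log_one_add_exp_mul_logistic hz (by positivity : 0 < b ^ 2)]
  have h2 : ∀ v : ℝ, Complex.log (1 + Complex.exp v) *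
      (b * (-2 * Real.pi * Complex.I * logistic (z - ((b ^ 2 : ℝ) : ℂ) * v))) =
      (b * (-2 * Real.pi * Complex.I)) *
        (Complex.log (1 + Complex.exp v) * logistic (z - ((b ^ 2 : ℝ) : ℂ) * v)) := fun v => by ring
  simp_rw [h2]
  rw [integral_const_mul]
  push_cast
  field_simp
  ring

/-! ### Holomorphy of both sides -/

/-- Faddeev's integrand decays exponentially, locally uniformly in `b` and `w`. -/
theorem eventually_norm_faddeevIntegrand_le {b₀ w₀ : ℂ} {ε : ℝ} (hb : 0 < b₀.re) (hε : 0 < ε)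
    (hε1 : ε < Real.pi * b₀.re) (hε2 : ε < Real.pi * (b₀⁻¹).re)
    (hw : |w₀.im| < (b₀ + b₀⁻¹).re / 2) :
    ∃ k > 0, ∃ C, ∀ᶠ q : ℂ × ℂ in 𝓝 (b₀, w₀), ∀ t : ℝ,
      ‖faddeevIntegrand q.1 q.2 ((t : ℂ) + ε * Complex.I)‖ ≤ C * Real.exp (-(k * |t|)) := by
  have hb0 : b₀ ≠ 0 := by rintro rfl; simp at hb
  have hbi : 0 < (b₀⁻¹).re := by
    by_contra! h
    nlinarith [Real.pi_pos]
  rw [Complex.add_re] at hw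
  set η := (b₀.re + (b₀⁻¹).re - 2 * |w₀.im|) / 4 with hη
  have hη0 : 0 < η := by simp only [hη]; linarith
  have hne : ∀ ω : ℂ, 0 < ω.re → ε < Real.pi * (ω⁻¹).re → ∀ t : ℝ,
      Complex.sinh (ω * t + ε * Complex.I * ω) ≠ 0 := fun ω h1 h2 t => by
    rw [show ω * t + ε * Complex.I * ω = ((t : ℂ) + ε * Complex.I) * ω by ring]
    exact sinh_mul_ne_zero h1 (by simpa using hε) (by simpa using h2)
  obtain ⟨m₁, hm₁, h1⟩ := eventually_exp_le_norm_sinh (k := b₀.re - η) hb (by linarith)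
    (hne b₀ hb hε2)
  obtain ⟨m₂, hm₂, h2⟩ := eventually_exp_le_norm_sinh (k := (b₀⁻¹).re - η) hbi (by linarith)
    (hne b₀⁻¹ hbi (by rwa [inv_inv]))
  have t1 : Tendsto (fun q : ℂ × ℂ => (q.1, ε * Complex.I * q.1)) (𝓝 (b₀, w₀))
      (𝓝 (b₀, ε * Complex.I * b₀)) :=
    (by fun_prop : Continuous fun q : ℂ × ℂ => (q.1, ε * Complex.I * q.1)).continuousAt
  have t2 : Tendsto (fun q : ℂ × ℂ => (q.1⁻¹, ε * Complex.I * q.1⁻¹)) (𝓝 (b₀, w₀))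
      (𝓝 (b₀⁻¹, ε * Complex.I * b₀⁻¹)) :=
    (by fun_prop (disch := assumption) :
      ContinuousAt (fun q : ℂ × ℂ => (q.1⁻¹, ε * Complex.I * q.1⁻¹)) (b₀, w₀))
  have h3 : ∀ᶠ q : ℂ × ℂ in 𝓝 (b₀, w₀), |q.2.im| < |w₀.im| + η / 2 :=
    (Complex.continuous_im.comp continuous_snd).abs.continuousAt.eventually
      (gt_mem_nhds (by simp; linarith))
  have h4 : ∀ᶠ q : ℂ × ℂ in 𝓝 (b₀, w₀), q.2.re < w₀.re + 1 :=
    (Complex.continuous_re.comp continuous_snd).continuousAt.eventually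
      (gt_mem_nhds (by simp))
  refine ⟨η, hη0, Real.exp (2 * ε * (w₀.re + 1)) / (4 * m₁ * m₂ * ε), ?_⟩
  filter_upwards [t1.eventually h1, t2.eventually h2, h3, h4] with q q1 q2 q3 q4 t
  have s1 := q1 t
  have s2 := q2 t
  rw [show q.1 * t + ε * Complex.I * q.1 = ((t : ℂ) + ε * Complex.I) * q.1 by ring] at s1
  rw [show q.1⁻¹ * t + ε * Complex.I * q.1⁻¹ = ((t : ℂ) + ε * Complex.I) / q.1 by
    rw [div_eq_mul_inv]; ring] at s2
  set x : ℂ := (t : ℂ) + ε * Complex.I with hx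
  have hxn : ε ≤ ‖x‖ := by
    have := Complex.abs_im_le_norm x
    have him : x.im = ε := by simp [hx]
    rwa [him, abs_of_pos hε] at this
  have hnum : ‖Complex.exp (-2 * Complex.I * x * q.2)‖ ≤
      Real.exp (2 * ε * (w₀.re + 1)) * Real.exp ((2 * |w₀.im| + η) * |t|) := by
    rw [Complex.norm_exp, ← Real.exp_add]
    have e : (-2 * Complex.I * x * q.2).re = 2 * ε * q.2.re + 2 * (t * q.2.im) := by
      simp [hx]
      ring
    have h5 : t * q.2.im ≤ |q.2.im| * |t| := by
      rw [← abs_mul, mul_comm]; exact le_abs_self _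
    have h6 : 2 * (t * q.2.im) ≤ (2 * |w₀.im| + η) * |t| := by nlinarith [abs_nonneg t]
    rw [e]
    refine Real.exp_le_exp.2 (add_le_add ?_ h6)
    gcongr
  rw [faddeevIntegrand, norm_div, norm_mul, norm_mul, norm_mul, Complex.norm_ofNat]
  calc _ ≤ Real.exp (2 * ε * (w₀.re + 1)) * Real.exp ((2 * |w₀.im| + η) * |t|) /
        (4 * (m₁ * Real.exp ((b₀.re - η) * |t|)) * (m₂ * Real.exp (((b₀⁻¹).re - η) * |t|)) * ε) := by
        gcongr
    _ = Real.exp (2 * ε * (w₀.re + 1)) / (4 * m₁ * m₂ * ε) * (Real.exp ((2 * |w₀.im| + η) * |t|) *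
        (Real.exp ((b₀.re - η) * |t|))⁻¹ * (Real.exp (((b₀⁻¹).re - η) * |t|))⁻¹) := by
        field_simp
    _ = _ := by
        rw [← Real.exp_neg, ← Real.exp_neg, ← Real.exp_add, ← Real.exp_add]
        congr 2
        simp only [hη]
        ring

theorem measurable_faddeevIntegrand (b w p : ℂ) :
    Measurable fun t : ℝ => faddeevIntegrand b w ((t : ℂ) + p) := by
  unfold faddeevIntegrand
  fun_prop

theorem integrable_faddeevIntegrand {b w : ℂ} {ε : ℝ} (hb : 0 < b.re) (hε : 0 < ε)
    (hε1 : ε < Real.pi * b.re) (hε2 : ε < Real.pi * (b⁻¹).re) (hw : |w.im| < (b + b⁻¹).re / 2) :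
    Integrable fun t : ℝ => faddeevIntegrand b w ((t : ℂ) + ε * Complex.I) := by
  obtain ⟨k, hk, C, h⟩ := eventually_norm_faddeevIntegrand_le hb hε hε1 hε2 hw
  exact ((integrable_exp_neg_mul_abs hk).const_mul C).mono'
    (measurable_faddeevIntegrand b w _).aestronglyMeasurable (Eventually.of_forall h.self_of_nhds)

/-- Faddeev's integral is holomorphic along any holomorphic family of parameters `(b, w)`. -/
theorem differentiableAt_integral_faddeevIntegrand {β ω : ℂ → ℂ} {p₀ : ℂ} {ε : ℝ}
    (hβ : ∀ᶠ p in 𝓝 p₀, DifferentiableAt ℂ β p) (hω : ∀ᶠ p in 𝓝 p₀, DifferentiableAt ℂ ω p)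
    (hb : 0 < (β p₀).re) (hε : 0 < ε) (hε1 : ε < Real.pi * (β p₀).re)
    (hε2 : ε < Real.pi * ((β p₀)⁻¹).re) (hw : |(ω p₀).im| < (β p₀ + (β p₀)⁻¹).re / 2) :
    DifferentiableAt ℂ
      (fun p => ∫ t : ℝ, faddeevIntegrand (β p) (ω p) ((t : ℂ) + ε * Complex.I)) p₀ := by
  obtain ⟨k, hk, C, h⟩ := eventually_norm_faddeevIntegrand_le hb hε hε1 hε2 hw
  have hβc := hβ.self_of_nhds.continuousAt
  have hωc := hω.self_of_nhds.continuousAt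
  have hb0 : β p₀ ≠ 0 := fun h => by simp [h] at hb
  have hbic : ContinuousAt (fun p => (β p)⁻¹) p₀ := hβc.inv₀ hb0
  have e1 : ∀ᶠ p in 𝓝 p₀, 0 < (β p).re :=
    (Complex.continuous_re.continuousAt.comp hβc).eventually (lt_mem_nhds hb)
  have e2 : ∀ᶠ p in 𝓝 p₀, ε < Real.pi * (β p).re :=
    (continuousAt_const.mul (Complex.continuous_re.continuousAt.comp hβc)).eventually
      (lt_mem_nhds hε1)
  have e3 : ∀ᶠ p in 𝓝 p₀, ε < Real.pi * ((β p)⁻¹).re :=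
    (continuousAt_const.mul (Complex.continuous_re.continuousAt.comp hbic)).eventually
      (lt_mem_nhds hε2)
  have e4 := (hβc.prodMk hωc).eventually h
  refine differentiableAt_integral_of_dominated
    (inter_mem (inter_mem hβ hω) (inter_mem (inter_mem e1 e2) (inter_mem e3 e4)))
    (fun p _ => (measurable_faddeevIntegrand _ _ _).aestronglyMeasurable)
    (Eventually.of_forall fun t p hp => ?_) (Eventually.of_forall fun t p hp => hp.2.2.2 t)
    ((integrable_exp_neg_mul_abs hk).const_mul C)
  obtain ⟨⟨d1, d2⟩, ⟨f1, f2⟩, f3, -⟩ := hp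
  simp only [mem_ofPred_eq] at d1 d2 f1 f2 f3
  have hp0 : β p ≠ 0 := fun h => by simp [h] at f1
  have hpi : 0 < ((β p)⁻¹).re := by
    by_contra! h
    nlinarith [Real.pi_pos]
  have hxim : ((t : ℂ) + ε * Complex.I).im = ε := by simp
  have n1 : Complex.sinh (((t : ℂ) + ε * Complex.I) * β p) ≠ 0 :=
    sinh_mul_ne_zero f1 (by rw [hxim]; exact hε) (by rw [hxim]; exact f3)
  have n2 : Complex.sinh (((t : ℂ) + ε * Complex.I) / β p) ≠ 0 := by
    rw [div_eq_mul_inv]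
    exact sinh_mul_ne_zero hpi (by rw [hxim]; exact hε) (by rw [hxim, inv_inv]; exact f2)
  have n3 : (t : ℂ) + ε * Complex.I ≠ 0 := fun h => by simp [h] at hxim; linarith
  have : DifferentiableAt ℂ
      (fun p => faddeevIntegrand (β p) (ω p) ((t : ℂ) + ε * Complex.I)) p := by
    unfold faddeevIntegrand
    refine DifferentiableAt.div (by fun_prop) (by fun_prop (disch := assumption)) ?_
    exact mul_ne_zero (mul_ne_zero (mul_ne_zero (by norm_num) n1) n2) n3
  exact this.differentiableWithinAt

theorem measurable_logistic : Measurable logistic := by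
  unfold logistic
  fun_prop

theorem differentiableAt_laplaceLogDilog_right {κ z : ℂ} (hκ : 0 < κ.re) (hz : |z.im| < Real.pi) :
    DifferentiableAt ℂ (laplaceLogDilog κ) z := by
  obtain ⟨Y, hY1, hY2⟩ := exists_between hz
  have hY0 : 0 < Y := (abs_nonneg _).trans_lt hY1
  set U : Set ℂ := {z | |z.im| < Y}
  set K := max 1 (1 / Real.sin Y)
  have hU : IsOpen U := isOpen_strip Y
  have hK : ∀ s : ℂ, |s.im| < Y → ‖logistic s‖ ≤ K := fun s hs => norm_logistic_le hY0 hs.le hY2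
  have hlap : ∀ a : ℝ, DifferentiableOn ℂ (fun z => logisticLaplace κ z a 0) U := by
    intro a z₀ hz₀
    simp only [logisticLaplace, iteratedDeriv_zero]
    refine (differentiableAt_integral_of_dominated (hU.mem_nhds hz₀) (fun p _ => ?_)
      (Eventually.of_forall fun v p hp => ?_)
      (Eventually.of_forall fun v p hp => norm_exp_neg_mul_mul_le (κ := κ) (v := v) (C := K + K) ?_)
      (integrableOn_exp_neg_mul_const hκ (K + K))).differentiableWithinAt
    · have := measurable_logistic
      exact (by fun_prop : Measurable _).aestronglyMeasurable
    · have h1 := differentiableAt_logistic (z := p + a * v) (by simpa using lt_trans hp hY2)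
      have h2 := differentiableAt_logistic (z := p - a * v) (by simpa using lt_trans hp hY2)
      have h3 : DifferentiableAt ℂ (fun p => logistic (p + a * v)) p :=
        DifferentiableAt.comp (g := logistic) p h1 (by fun_prop)
      have h4 : DifferentiableAt ℂ (fun p => logistic (p - a * v)) p :=
        DifferentiableAt.comp (g := logistic) p h2 (by fun_prop)
      exact ((h3.add h4).const_mul _).differentiableWithinAt
    · have hp' : |p.im| < Y := hp
      exact norm_add_le_of_le (hK _ (by simpa using hp')) (hK _ (by simpa using hp'))
  have hsum : DifferentiableOn ℂ (fun z => ∑' k : ℕ, (-1 : ℂ) ^ k / ((k : ℂ) + 1) ^ 2 *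
      logisticLaplace κ z (1 / ((k : ℝ) + 1)) 0) U :=
    Complex.differentiableOn_tsum_of_summable_norm
      (hasSum_inv_succ_sq.summable.mul_right (2 * K / κ.re))
      (fun k => (hlap _).const_mul _) hU fun k w hw =>
        norm_mul_le_of_le (norm_alternating_term_le k 0)
          (norm_logisticLaplace_le hκ (fun s hs => by
            rw [iteratedDeriv_zero]
            exact hK s (by rw [hs]; exact hw)) _)
  exact ((hasDerivAt_dilog_neg_exp hz).differentiableAt.const_mul _).add
    ((hsum.differentiableAt (hU.mem_nhds hY1)).const_mul _)

theorem differentiableAt_laplaceLogDilog_left {κ z : ℂ} (hκ : 0 < κ.re) (hz : |z.im| < Real.pi) :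
    DifferentiableAt ℂ (fun κ => laplaceLogDilog κ z) κ := by
  obtain ⟨r, hr0, hr⟩ := exists_between hκ
  obtain ⟨K, hK⟩ := exists_norm_iteratedDeriv_logistic_line_le hz 0
  have hK0 : 0 ≤ K := (norm_nonneg _).trans (hK z rfl)
  set U : Set ℂ := {κ | r < κ.re}
  have hU : IsOpen U := isOpen_lt continuous_const Complex.continuous_re
  have hlap : ∀ a : ℝ, DifferentiableOn ℂ (fun κ => logisticLaplace κ z a 0) U := by
    intro a κ₀ hκ₀
    simp only [logisticLaplace]
    refine (differentiableAt_integral_of_dominated (hU.mem_nhds hκ₀) (fun p _ => ?_)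
      (Eventually.of_forall fun v => ?_)
      ((ae_restrict_iff' measurableSet_Ioi).2 (Eventually.of_forall fun v (hv : 0 < v) p hp =>
        (norm_exp_neg_mul_mul_le (C := K + K) ?_).trans ?_))
      (integrableOn_exp_neg_mul_const hr0 (K + K))).differentiableWithinAt
    · have := measurable_logistic
      simp only [iteratedDeriv_zero]
      exact (by fun_prop : Measurable _).aestronglyMeasurable
    · fun_prop
    · exact norm_add_le_of_le (hK _ (by simp)) (hK _ (by simp))
    · have : r < p.re := hp
      gcongr
  have hsum : DifferentiableOn ℂ (fun κ => ∑' k : ℕ, (-1 : ℂ) ^ k / ((k : ℂ) + 1) ^ 2 *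
      logisticLaplace κ z (1 / ((k : ℝ) + 1)) 0) U :=
    Complex.differentiableOn_tsum_of_summable_norm
      (hasSum_inv_succ_sq.summable.mul_right (2 * K / r))
      (fun k => (hlap _).const_mul _) hU fun k w hw =>
        norm_mul_le_of_le (norm_alternating_term_le k 0) <| by
          have hw' : r < w.re := hw
          refine (norm_logisticLaplace_le (hr0.trans hw') hK _).trans ?_
          gcongr
  unfold laplaceLogDilog
  exact ((differentiableAt_id.div_const _).mul_const _).add
    ((hsum.differentiableAt (hU.mem_nhds hr)).const_mul _)

/-! ### Analytic continuation in `b` and in `z` -/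

/-- Continuation in `b`: for `|z| < 1` the integral converges for every `b` in the sector
`|arg b| < π / 4`. In terms of `b` the condition `ε < π Re (1 / b)` says that `b` lies in a disc, so
that the admissible `b` form a convex set. -/
theorem integral_faddeevIntegrand_of_norm_lt_one {b z : ℂ} {ε : ℝ} (hb : |b.im| < b.re)
    (hz : ‖z‖ < 1) (hε : 0 < ε) (hε1 : ε < Real.pi * b.re) (hε2 : ε < Real.pi * (b⁻¹).re) :
    ∫ t : ℝ, faddeevIntegrand b (z / (2 * Real.pi * b)) ((t : ℂ) + ε * Complex.I) =
      laplaceLogDilog (b ^ 2)⁻¹ z := by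
  have hpi := Real.pi_pos
  have hzim : |z.im| < Real.pi := by
    linarith [Complex.abs_im_le_norm z, Real.pi_gt_three]
  set D : Set ℂ := ({b | |b.im| < b.re} ∩ {b | ε < Real.pi * b.re}) ∩
    {b | ε * (b.re ^ 2 + b.im ^ 2) < Real.pi * b.re} with hD
  have hDo : IsOpen D := by
    refine ((isOpen_lt ?_ ?_).inter (isOpen_lt ?_ ?_)).inter (isOpen_lt ?_ ?_) <;> fun_prop
  have hDc : Convex ℝ D := by
    intro x hx y hy α β hα hβ hαβ
    obtain ⟨⟨x1, x2⟩, x3⟩ := hx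
    obtain ⟨⟨y1, y2⟩, y3⟩ := hy
    simp only [mem_ofPred_eq] at x1 x2 x3 y1 y2 y3
    have hpos : ∀ p q : ℝ, 0 < p → 0 < q → 0 < α * p + β * q := fun p q hp hq =>
      convex_Ioi (0 : ℝ) hp hq hα hβ hαβ
    have hre : (α • x + β • y).re = α * x.re + β * y.re := by simp
    have him : (α • x + β • y).im = α * x.im + β * y.im := by simp
    simp only [hD, mem_inter_iff, mem_ofPred_eq, hre, him]
    refine ⟨⟨?_, ?_⟩, ?_⟩
    · have h1 : |α * x.im + β * y.im| ≤ α * |x.im| + β * |y.im| := by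
        refine (abs_add_le _ _).trans_eq ?_
        rw [abs_mul, abs_mul, abs_of_nonneg hα, abs_of_nonneg hβ]
      have := hpos _ _ (sub_pos.2 x1) (sub_pos.2 y1)
      linarith
    · have := hpos _ _ (sub_pos.2 x2) (sub_pos.2 y2)
      have h1 : ε = α * ε + β * ε := by rw [← add_mul, hαβ, one_mul]
      linarith
    · have := hpos _ _ (sub_pos.2 x3) (sub_pos.2 y3)
      have h1 : (α * x.re + β * y.re) ^ 2 + (α * x.im + β * y.im) ^ 2 ≤
          α * (x.re ^ 2 + x.im ^ 2) + β * (y.re ^ 2 + y.im ^ 2) := by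
        obtain rfl : β = 1 - α := by linarith
        nlinarith [mul_nonneg (mul_nonneg hα hβ) (sq_nonneg (x.re - y.re)),
          mul_nonneg (mul_nonneg hα hβ) (sq_nonneg (x.im - y.im))]
      have h2 := mul_le_mul_of_nonneg_left h1 hε.le
      linarith
  have hinv : ∀ c : ℂ, |c.im| < c.re → (c ∈ D ↔ ε < Real.pi * c.re ∧ ε < Real.pi * (c⁻¹).re) := by
    intro c hc
    have hcre : 0 < c.re := (abs_nonneg _).trans_lt hc
    have hn : 0 < c.re ^ 2 + c.im ^ 2 := by positivity
    have : (c⁻¹).re = c.re / (c.re ^ 2 + c.im ^ 2) := by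
      rw [Complex.inv_re, Complex.normSq_apply, sq, sq]
    simp only [hD, mem_inter_iff, mem_ofPred_eq, hc, true_and, this]
    rw [mul_div_assoc', lt_div_iff₀ hn]
  have hbD : b ∈ D := (hinv b hb).2 ⟨hε1, hε2⟩
  have hεpi : ε < Real.pi := by
    obtain ⟨⟨-, h2⟩, h3⟩ := hbD
    simp only [mem_ofPred_eq] at h2 h3
    by_contra! h
    have h4 : 1 < b.re := by nlinarith
    have h5 : ε * b.re < ε * b.re ^ 2 := by nlinarith [mul_pos hε (by linarith : 0 < b.re)]
    nlinarith [mul_nonneg hε.le (sq_nonneg b.im)]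
  have h1D : (1 : ℂ) ∈ D := (hinv 1 (by simp)).2 (by simpa using hεpi)
  have hf : DifferentiableOn ℂ (fun c => ∫ t : ℝ, faddeevIntegrand c (z / (2 * Real.pi * c))
      ((t : ℂ) + ε * Complex.I)) D := by
    intro c hc
    have hc1 : |c.im| < c.re := hc.1.1
    have hcre : 0 < c.re := (abs_nonneg _).trans_lt hc1
    have hc0 : c ≠ 0 := fun h => by simp [h] at hcre
    obtain ⟨h1, h2⟩ := (hinv c hc1).1 hc
    refine (differentiableAt_integral_faddeevIntegrand (β := fun c => c)
      (ω := fun c => z / (2 * Real.pi * c)) (Eventually.of_forall fun _ => differentiableAt_fun_id)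
      ?_ hcre hε h1 h2 ?_).differentiableWithinAt
    · filter_upwards [isOpen_ne.mem_nhds hc0] with p hp
      refine DifferentiableAt.div (by fun_prop) (by fun_prop) ?_
      exact mul_ne_zero (mul_ne_zero two_ne_zero (by exact_mod_cast hpi.ne')) hp
    · -- `|c| < 2 Re c < π Re c` in the sector
      have hcn : 0 < ‖c‖ := norm_pos_iff.2 hc0
      have h3 : ‖c‖ ≤ Real.pi * c.re := by
        have := Complex.norm_le_abs_re_add_abs_im c
        rw [abs_of_pos hcre] at this
        nlinarith [Real.pi_gt_three]
      calc _ ≤ ‖z / (2 * Real.pi * c)‖ := Complex.abs_im_le_norm _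
        _ = ‖z‖ / (2 * Real.pi * ‖c‖) := by
            simp [abs_of_pos hpi]
        _ ≤ 1 / (2 * Real.pi * ‖c‖) := by gcongr
        _ ≤ c.re / (2 * ‖c‖ ^ 2) := by
            rw [div_le_div_iff₀ (by positivity) (by positivity)]
            nlinarith
        _ < _ := by
            rw [Complex.add_re, Complex.inv_re, ← Complex.sq_norm]
            have : c.re / (2 * ‖c‖ ^ 2) = c.re / ‖c‖ ^ 2 / 2 := by field_simp
            linarith
  have hg : DifferentiableOn ℂ (fun c => laplaceLogDilog (c ^ 2)⁻¹ z) D := by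
    intro c hc
    have hc1 : |c.im| < c.re := hc.1.1
    have hcre : 0 < c.re := (abs_nonneg _).trans_lt hc1
    have hc0 : c ≠ 0 := fun h => by simp [h] at hcre
    have hsq : 0 < (c ^ 2).re := by
      rw [sq, Complex.mul_re]
      nlinarith [abs_lt.1 hc1]
    have hκ : 0 < ((c ^ 2)⁻¹).re := by
      rw [Complex.inv_re]
      exact div_pos hsq (Complex.normSq_pos.2 (pow_ne_zero 2 hc0))
    have h1 := differentiableAt_laplaceLogDilog_left hκ hzim
    have h2 : DifferentiableAt ℂ (fun c : ℂ => (c ^ 2)⁻¹) c :=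
      (differentiableAt_id.pow 2).inv (pow_ne_zero 2 hc0)
    exact (DifferentiableAt.comp (g := fun κ => laplaceLogDilog κ z) c h1 h2).differentiableWithinAt
  refine eqOn_of_eventually_eq_add_ofReal hDo hDc.isPreconnected hf hg h1D ?_ hbD
  have e1 : ∀ᶠ r : ℝ in 𝓝 0, 0 < 1 + r :=
    (by fun_prop : Continuous fun r : ℝ => 1 + r).continuousAt.eventually (lt_mem_nhds (by simp))
  have e2 : ∀ᶠ r : ℝ in 𝓝 0, ε * (1 + r) < Real.pi :=
    (by fun_prop : Continuous fun r : ℝ => ε * (1 + r)).continuousAt.eventually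
      (gt_mem_nhds (by simpa using hεpi))
  have e3 : ∀ᶠ r : ℝ in 𝓝 0, ε / (1 + r) < Real.pi :=
    (by fun_prop (disch := norm_num) :
      ContinuousAt (fun r : ℝ => ε / (1 + r)) 0).eventually (gt_mem_nhds (by simpa using hεpi))
  filter_upwards [e1, e2, e3] with r r1 r2 r3
  have := integral_faddeevIntegrand_ofReal hzim r1 hε r2 r3
  push_cast at this
  exact this

/-- Continuation in `z`, from a neighbourhood of `0` to the convex set of all admissible `z`. -/
theorem integral_faddeevIntegrand_eq {b z : ℂ} {ε : ℝ} (hb : |b.im| < b.re)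
    (hz : |z.im| < Real.pi) (hw : |(z / (2 * Real.pi * b)).im| < (b + b⁻¹).re / 2)
    (hε : 0 < ε) (hε1 : ε < Real.pi * b.re) (hε2 : ε < Real.pi * (b⁻¹).re) :
    ∫ t : ℝ, faddeevIntegrand b (z / (2 * Real.pi * b)) ((t : ℂ) + ε * Complex.I) =
      laplaceLogDilog (b ^ 2)⁻¹ z := by
  have hpi := Real.pi_pos
  have hbre : 0 < b.re := (abs_nonneg _).trans_lt hb
  have hb0 : b ≠ 0 := fun h => by simp [h] at hbre
  have hκ : 0 < ((b ^ 2)⁻¹).re := by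
    rw [Complex.inv_re]
    refine div_pos ?_ (Complex.normSq_pos.2 (pow_ne_zero 2 hb0))
    rw [sq, Complex.mul_re]
    nlinarith [abs_lt.1 hb]
  set U : Set ℂ := {z | |z.im| < Real.pi} ∩
    {z | |(z / (2 * Real.pi * b)).im| < (b + b⁻¹).re / 2} with hU
  have hUo : IsOpen U := (isOpen_strip _).inter
    ((isOpen_strip _).preimage (by fun_prop : Continuous fun z : ℂ => z / (2 * Real.pi * b)))
  have hUc : Convex ℝ U := by
    refine (convex_strip _).inter ?_
    have := (convex_strip ((b + b⁻¹).re / 2)).linear_preimage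
      ((LinearMap.mulRight ℂ (2 * Real.pi * b)⁻¹).restrictScalars ℝ)
    exact this
  have hf : DifferentiableOn ℂ (fun z => ∫ t : ℝ, faddeevIntegrand b (z / (2 * Real.pi * b))
      ((t : ℂ) + ε * Complex.I)) U := fun z hz =>
    (differentiableAt_integral_faddeevIntegrand (β := fun _ => b)
      (ω := fun z => z / (2 * Real.pi * b)) (Eventually.of_forall fun _ => by fun_prop)
      (Eventually.of_forall fun _ => by fun_prop) hbre hε hε1 hε2 hz.2).differentiableWithinAt
  have hg : DifferentiableOn ℂ (laplaceLogDilog (b ^ 2)⁻¹) U := fun z hz =>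
    (differentiableAt_laplaceLogDilog_right hκ hz.1).differentiableWithinAt
  have hS : 0 < (b + b⁻¹).re / 2 := (abs_nonneg _).trans_lt hw
  refine eqOn_of_eventually_eq_add_ofReal (z₀ := 0) hUo hUc.isPreconnected hf hg
    ⟨by simpa using hpi, by simpa using hS⟩ ?_ ⟨hz, hw⟩
  filter_upwards [Metric.ball_mem_nhds (0 : ℝ) one_pos] with r hr
  exact integral_faddeevIntegrand_of_norm_lt_one hb (by simpa using hr) hε hε1 hε2

theorem corollary1p4 (τ b : ℂ) (hτ : 0 < τ.re) (hb : 0 < b.re) (hbτ : b ^ 2 = τ) :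
    (∃ ℓ : ℂ → ℂ, IsLogQuantumDilog b ℓ) ∧
    ∀ ℓ : ℂ → ℂ, IsLogQuantumDilog b ℓ →
      ∀ δ : ℝ, 0 < δ → δ < Real.pi → ∀ z : ℂ, |z.im| < Real.pi - δ → ∀ N : ℕ,
        ‖ℓ z - ∑ n ∈ Finset.range (N + 1), asympTerm τ z n‖ ≤
          max 2 (Real.pi ^ 2 / (3 * Real.sin (|z.im| + δ))) * (2 / δ) ^ (2 * N) *
            (Nat.factorial (2 * N) : ℝ) * (‖τ‖ ^ 2 / τ.re) * ‖τ‖ ^ (2 * N) := by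
  subst hbτ
  have hpi := Real.pi_pos
  have hb0 : b ≠ 0 := fun h => by simp [h] at hb
  have hsector : |b.im| < b.re := by
    rw [sq, Complex.mul_re] at hτ
    exact abs_lt_of_sq_lt_sq (by nlinarith) hb.le
  have hκ : 0 < ((b ^ 2)⁻¹).re := by
    rw [Complex.inv_re]
    exact div_pos hτ (Complex.normSq_pos.2 (pow_ne_zero 2 hb0))
  have hbi : 0 < (b⁻¹).re := by
    rw [Complex.inv_re]
    exact div_pos hb (Complex.normSq_pos.2 hb0)
  have hε12 : ∀ ε : ℝ, ε < Real.pi * min b.re (b⁻¹).re →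
      ε < Real.pi * b.re ∧ ε < Real.pi * (b⁻¹).re := fun ε h =>
    ⟨h.trans_le (by gcongr; exact min_le_left _ _), h.trans_le (by gcongr; exact min_le_right _ _)⟩
  have hhol : DifferentiableOn ℂ (laplaceLogDilog (b ^ 2)⁻¹) {z : ℂ | |z.im| < Real.pi} :=
    fun z hz => (differentiableAt_laplaceLogDilog_right hκ hz).differentiableWithinAt
  refine ⟨⟨laplaceLogDilog (b ^ 2)⁻¹, hhol, fun z _ hw ε hε hε' =>
    integrable_faddeevIntegrand hb hε (hε12 ε hε').1 (hε12 ε hε').2 hw, fun z hz hw ε hε hε' =>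
    (integral_faddeevIntegrand_eq hsector hz hw hε (hε12 ε hε').1 (hε12 ε hε').2).symm⟩, ?_⟩
  intro ℓ hℓ δ hδ hδpi z hz N
  -- near `0` the line `Im x = ε` is admissible, so that `ℓ` is the closed form there
  obtain ⟨ε, hε, hε'⟩ := exists_between (mul_pos hpi (lt_min hb hbi))
  have hS : 0 < (b + b⁻¹).re / 2 := by rw [Complex.add_re]; positivity
  have hnear : ∀ᶠ r : ℝ in 𝓝 0, |(((0 : ℂ) + r) / (2 * Real.pi * b)).im| < (b + b⁻¹).re / 2 :=
    (by fun_prop : Continuous fun r : ℝ =>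
      |(((0 : ℂ) + r) / (2 * Real.pi * b)).im|).continuousAt.eventually
      (gt_mem_nhds (by simpa using hS))
  have heq := eqOn_of_eventually_eq_add_ofReal (z₀ := 0) (isOpen_strip Real.pi)
    (convex_strip _).isPreconnected hℓ.holomorphic hhol (by simpa using hpi) (by
      filter_upwards [hnear] with r hr
      have him : |((0 : ℂ) + r).im| < Real.pi := by simpa using hpi
      rw [hℓ.eq_integral _ him hr ε hε hε', integral_faddeevIntegrand_eq hsector him hr hε
        (hε12 ε hε').1 (hε12 ε hε').2])
  rw [heq (show |z.im| < Real.pi by linarith)]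
  exact norm_laplaceLogDilog_sub_sum_le hτ hδ hz N
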